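/- All quantum groups are quantum permutation groups: a \emph{quantum permutation group} of size $n\ge 1$ is a unital complex $*$-algebra $A$ generated by the entries of a matrix $u=(u_{ij})_{1\le i,j\le n}$, together with a unital $*$-morphism $\Delta\colon A\to A\otimes A$ (algebraic tensor product) with $\Delta(u_{ij})=\sum_k u_{ik}\otimes u_{kj}$, where $u$ is a \emph{magic unitary}: $u_{ij}=u_{ij}^*=u_{ij}^2$, every row and every column of $u$ sums to $1$, and distinct entries in the same row or in the same column have product $0$. An isomorphism is an isomorphism of unital $*$-algebras commuting with the comultiplications $\Delta$; families of quantum permutation groups are understood up to isomorphism. We use the following quantum permutation groups. - The trivial quantum group is $\mathbb{C}$ with $u=(1)$. - $S_n^+$ ($n\ge 1$) is the universal unital $*$-algebra generated by the entries of a magic unitary $p=(p_{ij})$ of size $n$. - For a finite simple graph $G$ with at least one vertex, the quantum automorphism group $\mathrm{Qu}(G)$ is the universal unital $*$-algebra generated by the entries of a magic unitary indexed by $V(G)$ and commuting with the adjacency matrix of $G$. - The free product of $(A,u)$ and $(B,v)$ is the unital free product $A*B$ with magic unitary $\mathrm{diag}(u,v)$. - For $X=(A,u)$ and $n\ge 1$,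 the wreath product $X\wr S_n^+$ is the quotient of the unital free product of $n$ copies of $A$ (with canonical maps $\nu_1,\dots,\nu_n$) and of the algebra of $S_n^+$ by the relations $\nu_i(a)p_{ij}=p_{ij}\nu_i(a)$ ($1\le i,j\le n$, $a\in A$), with magic unitary $w_{(i,k),(j,l)}=\nu_i(u_{kl})p_{ij}$. In each case the comultiplication is the one determined by the displayed magic unitary. \textbf{Theorem (noncommutative Jordan theorem).} The family of quantum automorphism groups of finite trees is the smallest family $\mathcal{I}$ of quantum permutation groups such that 1. $\mathcal{I}$ contains the trivial quantum group; 2. if $A,B\in\mathcal{I}$, then $A*B\in\mathcal{I}$; 3. if $A\in\mathcal{I}$ and $n\ge 1$, then $A\wr S_n^+\in\mathcal{I}$. That is, the family of quantum automorphism groups of finite trees satisfies 1, 2 and 3, and it is contained in every family of quantum permutation groups satisfying 1, 2 and 3. -/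

import Mathlib

set_option linter.unusedSectionVars false

open scoped TensorProduct

/-! ## Unital complex *-algebras given by generators and relations -/

/-- The free unital complex *-algebra on `X`, that is, the algebra of noncommutative *-polynomials
in variables indexed by `X`: the free algebra on the letters `(x, false)`, standing for `x`, and
`(x, true)`, standing for `x*`. -/
def FreeStarAlgebra (X : Type) : Type := FreeAlgebra ℂ (X × Bool)

namespace FreeStarAlgebra

variable {X : Type}

noncomputable instance : Ring (FreeStarAlgebra X) :=
  inferInstanceAs (Ring (FreeAlgebra ℂ (X × Bool)))

noncomputable instance : Algebra ℂ (FreeStarAlgebra X) :=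
  inferInstanceAs (Algebra ℂ (FreeAlgebra ℂ (X × Bool)))

/-- The letter `p`. -/
noncomputable def letter (p : X × Bool) : FreeStarAlgebra X := FreeAlgebra.ι ℂ p

/-- The opposite of the free *-algebra, with complex scalars acting through conjugation. -/
def ConjOp (X : Type) : Type := (FreeStarAlgebra X)ᵐᵒᵖ

noncomputable instance : Ring (ConjOp X) := inferInstanceAs (Ring (FreeStarAlgebra X)ᵐᵒᵖ)

noncomputable instance : Algebra ℂ (ConjOp X) :=
  ((algebraMap ℂ (FreeStarAlgebra X)ᵐᵒᵖ).comp (starRingEnd ℂ)).toAlgebra'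
    fun c x => Algebra.commutes (A := (FreeStarAlgebra X)ᵐᵒᵖ) (starRingEnd ℂ c) x

/-- The involution, as a morphism to the conjugate opposite algebra: it exchanges the letters
`x` and `x*`. -/
noncomputable def starHom : FreeStarAlgebra X →ₐ[ℂ] ConjOp X :=
  FreeAlgebra.lift ℂ (fun p => (MulOpposite.op (letter (p.1, !p.2)) : (FreeStarAlgebra X)ᵐᵒᵖ))

/-- The involution, as a ring morphism to the opposite ring. -/
noncomputable def starAux : FreeStarAlgebra X →+* (FreeStarAlgebra X)ᵐᵒᵖ := starHom.toRingHom

theorem starAux_letter (p : X × Bool) :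
    starAux (letter p) = MulOpposite.op (letter (p.1, !p.2)) :=
  FreeAlgebra.lift_ι_apply (R := ℂ) (A := ConjOp X) _ p

theorem starAux_algebraMap (c : ℂ) :
    starAux (algebraMap ℂ (FreeStarAlgebra X) c)
      = MulOpposite.op (algebraMap ℂ (FreeStarAlgebra X) (starRingEnd ℂ c)) :=
  AlgHom.commutes starHom c

@[elab_as_elim]
theorem induction {C : FreeStarAlgebra X → Prop}
    (scalar : ∀ c, C (algebraMap ℂ _ c)) (letter : ∀ p, C (letter p))
    (mul : ∀ a b, C a → C b → C (a * b)) (add : ∀ a b, C a → C b → C (a + b))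
    (a : FreeStarAlgebra X) : C a :=
  FreeAlgebra.induction ℂ (X × Bool) (motive := C) scalar letter mul add a

noncomputable instance : StarRing (FreeStarAlgebra X) where
  star a := (starAux a).unop
  star_involutive a := by
    induction a using induction with
    | scalar c => simp [starAux_algebraMap]
    | letter p => simp [starAux_letter]
    | mul a b ha hb => simp_all
    | add a b ha hb => simp_all
  star_mul a b := by simp
  star_add a b := by simp

theorem star_letter (p : X × Bool) : star (letter p) = letter (p.1, !p.2) := by
  change (starAux (letter p)).unop = _
  rw [starAux_letter]; rfl

theorem star_algebraMap' (c : ℂ) :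
    star (algebraMap ℂ (FreeStarAlgebra X) c) = algebraMap ℂ _ (star c) := by
  change (starAux _).unop = _
  rw [starAux_algebraMap]; rfl

instance : StarModule ℂ (FreeStarAlgebra X) where
  star_smul c a := by
    rw [Algebra.smul_def, star_mul, star_algebraMap', Algebra.smul_def, Algebra.commutes]

/-- The variable indexed by `x`. -/
noncomputable def of (x : X) : FreeStarAlgebra X := letter (x, false)

section lift

variable {B : Type*} [Ring B] [StarRing B] [Algebra ℂ B] [StarModule ℂ B]

/-- Evaluation of *-polynomials, as a morphism of algebras. -/
noncomputable def liftAlg (f : X → B) : FreeStarAlgebra X →ₐ[ℂ] B :=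
  FreeAlgebra.lift ℂ (fun p : X × Bool => if p.2 then star (f p.1) else f p.1)

theorem liftAlg_letter (f : X → B) (p : X × Bool) :
    liftAlg f (letter p) = if p.2 then star (f p.1) else f p.1 :=
  FreeAlgebra.lift_ι_apply (R := ℂ) _ _

/-- Evaluation of *-polynomials at a family `f` of elements of a *-algebra. -/
noncomputable def lift (f : X → B) : FreeStarAlgebra X →⋆ₐ[ℂ] B where
  toAlgHom := liftAlg f
  map_star' a := by
    change liftAlg f (star a) = star (liftAlg f a)
    induction a using induction with
    | scalar c =>
      rw [star_algebraMap', AlgHom.commutes, AlgHom.commutes, algebraMap_star_comm]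
    | letter p => rw [star_letter, liftAlg_letter, liftAlg_letter]; rcases p with ⟨x, _ | _⟩ <;> simp
    | mul a b iha ihb => rw [star_mul, map_mul, map_mul, star_mul, iha, ihb]
    | add a b iha ihb => rw [star_add, map_add, map_add, star_add, iha, ihb]

@[simp] theorem lift_of (f : X → B) (x : X) : lift f (of x) = f x :=
  (liftAlg_letter f (x, false)).trans (by simp)

theorem hom_ext {f g : FreeStarAlgebra X →⋆ₐ[ℂ] B} (h : ∀ x, f (of x) = g (of x)) : f = g := by
  ext a
  induction a using induction with
  | scalar c => rw [AlgHomClass.commutes, AlgHomClass.commutes]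
  | letter p =>
    rcases p with ⟨x, _ | _⟩
    · exact h x
    · have : letter (x, true) = star (of x) := by rw [of, star_letter]; rfl
      rw [this, map_star, map_star, h]
  | mul a b ha hb => rw [map_mul, map_mul, ha, hb]
  | add a b ha hb => rw [map_add, map_add, ha, hb]

end lift

end FreeStarAlgebra

/-- The universal unital complex *-algebra generated by variables indexed by `X` with the relations
`P = 0` for `P ∈ R`: the quotient of the free *-algebra by the two-sided *-ideal generated
by `R`. -/
def PresentedStarAlgebra {X : Type} (R : Set (FreeStarAlgebra X)) : Type :=
  RingQuot (fun a b : FreeStarAlgebra X => (a ∈ R ∨ star a ∈ R) ∧ b = 0)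

namespace PresentedStarAlgebra

variable {X : Type} (R : Set (FreeStarAlgebra X))

noncomputable instance : Ring (PresentedStarAlgebra R) :=
  inferInstanceAs (Ring (RingQuot _))

noncomputable instance : Algebra ℂ (PresentedStarAlgebra R) :=
  inferInstanceAs (Algebra ℂ (RingQuot _))

theorem star_rel (a b : FreeStarAlgebra X) (h : (a ∈ R ∨ star a ∈ R) ∧ b = 0) :
    (star a ∈ R ∨ star (star a) ∈ R) ∧ star b = 0 := by
  rcases h with ⟨h, rfl⟩
  rw [star_star]
  exact ⟨h.symm, star_zero _⟩

noncomputable instance : StarRing (PresentedStarAlgebra R) :=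
  RingQuot.starRing _ (star_rel R)

/-- The quotient map, as a morphism of algebras. -/
noncomputable def mkAlg : FreeStarAlgebra X →ₐ[ℂ] PresentedStarAlgebra R :=
  RingQuot.mkAlgHom ℂ _

theorem mkAlg_surjective : Function.Surjective (mkAlg R) := RingQuot.mkAlgHom_surjective ℂ _

theorem mkAlg_star (a : FreeStarAlgebra X) : mkAlg R (star a) = star (mkAlg R a) := by
  simp only [mkAlg, RingQuot.mkAlgHom, RingQuot.mkRingHom]
  rfl

instance : StarModule ℂ (PresentedStarAlgebra R) where
  star_smul c a := by
    obtain ⟨a, rfl⟩ := mkAlg_surjective R a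
    rw [← map_smul, ← mkAlg_star, star_smul, map_smul, mkAlg_star]

/-- The quotient map. -/
noncomputable def mk : FreeStarAlgebra X →⋆ₐ[ℂ] PresentedStarAlgebra R where
  toAlgHom := mkAlg R
  map_star' := mkAlg_star R

theorem mk_surjective : Function.Surjective (mk R) := mkAlg_surjective R

variable {R}

theorem mk_eq_zero {P : FreeStarAlgebra X} (h : P ∈ R) : mk R P = 0 := by
  have := RingQuot.mkAlgHom_rel ℂ
    (s := fun a b : FreeStarAlgebra X => (a ∈ R ∨ star a ∈ R) ∧ b = 0) ⟨Or.inl h, rfl⟩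
  exact this.trans (map_zero (mkAlg R))

variable (R) in
/-- The generator indexed by `x`. -/
noncomputable def gen (x : X) : PresentedStarAlgebra R := mk R (FreeStarAlgebra.of x)

theorem adjoin_gen : StarAlgebra.adjoin ℂ (Set.range (gen R)) = ⊤ := by
  refine eq_top_iff.2 fun a _ => ?_
  obtain ⟨a, rfl⟩ := mk_surjective R a
  have hg : ∀ x, gen R x ∈ StarAlgebra.adjoin ℂ (Set.range (gen R)) := fun x =>
    StarAlgebra.subset_adjoin ℂ _ ⟨x, rfl⟩
  induction a using FreeStarAlgebra.induction with
  | scalar c => rw [AlgHomClass.commutes]; exact algebraMap_mem _ c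
  | letter p =>
    rcases p with ⟨x, _ | _⟩
    · exact hg x
    · have : FreeStarAlgebra.letter (x, true) = star (FreeStarAlgebra.of x) := by
        rw [FreeStarAlgebra.of, FreeStarAlgebra.star_letter]; rfl
      rw [this, map_star]
      exact star_mem (hg x)
  | mul a b ha hb => rw [map_mul]; exact mul_mem (ha trivial) (hb trivial)
  | add a b ha hb => rw [map_add]; exact add_mem (ha trivial) (hb trivial)

section lift

variable {B : Type*} [Ring B] [StarRing B] [Algebra ℂ B] [StarModule ℂ B]

/-- The universal property, as a morphism of algebras. -/
noncomputable def liftAlg (f : X → B) (hf : ∀ P ∈ R, FreeStarAlgebra.lift f P = 0) :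
    PresentedStarAlgebra R →ₐ[ℂ] B :=
  RingQuot.liftAlgHom ℂ ⟨(FreeStarAlgebra.lift f).toAlgHom, by
    rintro a b ⟨h | h, rfl⟩
    · exact (hf a h).trans (map_zero (FreeStarAlgebra.lift f)).symm
    · refine Eq.trans ?_ (map_zero (FreeStarAlgebra.lift f)).symm
      have := hf _ h
      rw [map_star, star_eq_zero] at this
      exact this⟩

theorem liftAlg_mk (f : X → B) (hf : ∀ P ∈ R, FreeStarAlgebra.lift f P = 0) (a) :
    liftAlg f hf (mk R a) = FreeStarAlgebra.lift f a :=
  RingQuot.liftAlgHom_mkAlgHom_apply ℂ _ _ a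

/-- The universal property: a family `f` in a *-algebra `B` satisfying the relations `R` defines a
morphism of *-algebras. -/
noncomputable def lift (f : X → B) (hf : ∀ P ∈ R, FreeStarAlgebra.lift f P = 0) :
    PresentedStarAlgebra R →⋆ₐ[ℂ] B where
  toAlgHom := liftAlg f hf
  map_star' a := by
    change liftAlg f hf (star a) = star (liftAlg f hf a)
    obtain ⟨a, rfl⟩ := mk_surjective R a
    rw [← map_star, liftAlg_mk, liftAlg_mk, map_star]

theorem lift_mk (f : X → B) (hf : ∀ P ∈ R, FreeStarAlgebra.lift f P = 0) (a) :
    lift f hf (mk R a) = FreeStarAlgebra.lift f a :=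
  liftAlg_mk f hf a

@[simp] theorem lift_gen (f : X → B) (hf : ∀ P ∈ R, FreeStarAlgebra.lift f P = 0) (x : X) :
    lift f hf (gen R x) = f x := by rw [gen, lift_mk, FreeStarAlgebra.lift_of]

theorem hom_ext {f g : PresentedStarAlgebra R →⋆ₐ[ℂ] B} (h : ∀ x, f (gen R x) = g (gen R x)) :
    f = g := by
  ext a
  obtain ⟨a, rfl⟩ := mk_surjective R a
  exact DFunLike.congr_fun (FreeStarAlgebra.hom_ext (f := f.comp (mk R)) (g := g.comp (mk R)) h) a

end lift

end PresentedStarAlgebra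

/-- For a map `j` from a *-algebra `A` to *-polynomials, the relations which express that `j`
is a morphism of unital *-algebras. -/
def homRelations {A : Type} [Ring A] [StarRing A] [Algebra ℂ A] {X : Type}
    (j : A → FreeStarAlgebra X) : Set (FreeStarAlgebra X) :=
  {P | ∃ a b, P = j (a + b) - (j a + j b)} ∪
  {P | ∃ a b, P = j (a * b) - j a * j b} ∪
  {P | ∃ c : ℂ, P = j (algebraMap ℂ A c) - algebraMap ℂ _ c} ∪
  {P | ∃ a, P = j (star a) - star (j a)}

section homRelations

variable {A : Type} [Ring A] [StarRing A] [Algebra ℂ A] {X : Type} {j : A → FreeStarAlgebra X}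

theorem homRelations_iff {B : Type*} [Ring B] [StarRing B] [Algebra ℂ B] [StarModule ℂ B]
    (φ : FreeStarAlgebra X →⋆ₐ[ℂ] B) :
    (∀ P ∈ homRelations j, φ P = 0) ↔ ∃ ψ : A →⋆ₐ[ℂ] B, ∀ a, φ (j a) = ψ a := by
  constructor
  · intro h
    have hadd : ∀ a b, φ (j (a + b)) = φ (j a) + φ (j b) := fun a b => by
      have := h _ (Or.inl (Or.inl (Or.inl ⟨a, b, rfl⟩)))
      rwa [map_sub, map_add, sub_eq_zero] at this
    have hmul : ∀ a b, φ (j (a * b)) = φ (j a) * φ (j b) := fun a b => by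
      have := h _ (Or.inl (Or.inl (Or.inr ⟨a, b, rfl⟩)))
      rwa [map_sub, map_mul, sub_eq_zero] at this
    have hsc : ∀ c : ℂ, φ (j (algebraMap ℂ A c)) = algebraMap ℂ B c := fun c => by
      have := h _ (Or.inl (Or.inr ⟨c, rfl⟩))
      rwa [map_sub, AlgHomClass.commutes, sub_eq_zero] at this
    have hst : ∀ a, φ (j (star a)) = star (φ (j a)) := fun a => by
      have := h _ (Or.inr ⟨a, rfl⟩)
      rwa [map_sub, map_star, sub_eq_zero] at this
    exact ⟨{ toFun := fun a => φ (j a)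
             map_one' := by simpa using hsc 1
             map_mul' := hmul
             map_zero' := by simpa using hsc 0
             map_add' := hadd
             commutes' := hsc
             map_star' := hst }, fun a => rfl⟩
  · rintro ⟨ψ, hψ⟩ P (((⟨a, b, rfl⟩ | ⟨a, b, rfl⟩) | ⟨c, rfl⟩) | ⟨a, rfl⟩)
    · simp [hψ]
    · simp [hψ]
    · simp [hψ, AlgHomClass.commutes]
    · simp [hψ, map_star]

/-- The morphism defined by `j` in a presented *-algebra whose relations contain
`homRelations j`. -/
noncomputable def homOfRelations (j : A → FreeStarAlgebra X) {R : Set (FreeStarAlgebra X)}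
    (h : homRelations j ⊆ R) : A →⋆ₐ[ℂ] PresentedStarAlgebra R :=
  let e := (homRelations_iff (j := j) (PresentedStarAlgebra.mk R)).1
    fun _ hP => PresentedStarAlgebra.mk_eq_zero (h hP)
  { toFun := fun a => PresentedStarAlgebra.mk R (j a)
    map_one' := by obtain ⟨ψ, hψ⟩ := e; simp [hψ]
    map_mul' := by obtain ⟨ψ, hψ⟩ := e; simp [hψ]
    map_zero' := by obtain ⟨ψ, hψ⟩ := e; simp [hψ]
    map_add' := by obtain ⟨ψ, hψ⟩ := e; simp [hψ]
    commutes' := by obtain ⟨ψ, hψ⟩ := e; simp [hψ, AlgHomClass.commutes]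
    map_star' := by obtain ⟨ψ, hψ⟩ := e; simp [hψ, map_star] }

end homRelations

/-- The tensor product of two morphisms of *-algebras. -/
noncomputable def StarAlgHom.tensorMap {A B C D : Type*}
    [Ring A] [StarRing A] [Algebra ℂ A] [StarModule ℂ A]
    [Ring B] [StarRing B] [Algebra ℂ B] [StarModule ℂ B]
    [Ring C] [StarRing C] [Algebra ℂ C] [StarModule ℂ C]
    [Ring D] [StarRing D] [Algebra ℂ D] [StarModule ℂ D]
    (f : A →⋆ₐ[ℂ] C) (g : B →⋆ₐ[ℂ] D) : A ⊗[ℂ] B →⋆ₐ[ℂ] C ⊗[ℂ] D where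
  toAlgHom := Algebra.TensorProduct.map f.toAlgHom g.toAlgHom
  map_star' x := by
    change Algebra.TensorProduct.map f.toAlgHom g.toAlgHom (star x)
      = star (Algebra.TensorProduct.map f.toAlgHom g.toAlgHom x)
    induction x using TensorProduct.induction_on with
    | zero => simp
    | tmul a b =>
      rw [TensorProduct.star_tmul, Algebra.TensorProduct.map_tmul, Algebra.TensorProduct.map_tmul,
        TensorProduct.star_tmul]
      exact congrArg₂ _ (map_star f a) (map_star g b)
    | add x y hx hy => rw [star_add, map_add, map_add, star_add, hx, hy]

@[simp] theorem StarAlgHom.tensorMap_tmul {A B C D : Type*}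
    [Ring A] [StarRing A] [Algebra ℂ A] [StarModule ℂ A]
    [Ring B] [StarRing B] [Algebra ℂ B] [StarModule ℂ B]
    [Ring C] [StarRing C] [Algebra ℂ C] [StarModule ℂ C]
    [Ring D] [StarRing D] [Algebra ℂ D] [StarModule ℂ D]
    (f : A →⋆ₐ[ℂ] C) (g : B →⋆ₐ[ℂ] D) (a : A) (b : B) :
    StarAlgHom.tensorMap f g (a ⊗ₜ b) = f a ⊗ₜ g b := rfl

/-! ## Magic unitaries and quantum permutation groups -/

section magic

variable {ι : Type} [Fintype ι]

/-- A square matrix over a *-algebra is a magic unitary if its entries are self-adjoint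
idempotents, each row and each column sums to `1`, and distinct entries of a row, or of a column,
are orthogonal. -/
structure IsMagicUnitary {A : Type*} [Ring A] [StarRing A] (u : Matrix ι ι A) : Prop where
  star_eq : ∀ i j, star (u i j) = u i j
  idem : ∀ i j, u i j * u i j = u i j
  row_sum : ∀ i, ∑ j, u i j = 1
  col_sum : ∀ j, ∑ i, u i j = 1
  row_orth : ∀ i j k, j ≠ k → u i j * u i k = 0
  col_orth : ∀ i k j, i ≠ k → u i j * u k j = 0

/-- The matrix of variables `x = (x i j)`. -/
noncomputable def varMatrix (ι : Type) : Matrix ι ι (FreeStarAlgebra (ι × ι)) :=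
  fun i j => FreeStarAlgebra.of (i, j)

variable (ι) in
/-- The defining relations of a magic unitary. -/
def magicRelations : Set (FreeStarAlgebra (ι × ι)) :=
  {P | ∃ i j : ι, P = star (varMatrix ι i j) - varMatrix ι i j} ∪
  {P | ∃ i j : ι, P = varMatrix ι i j * varMatrix ι i j - varMatrix ι i j} ∪
  {P | ∃ i : ι, P = ∑ j, varMatrix ι i j - 1} ∪
  {P | ∃ j : ι, P = ∑ i, varMatrix ι i j - 1} ∪
  {P | ∃ i j k : ι, j ≠ k ∧ P = varMatrix ι i j * varMatrix ι i k} ∪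
  {P | ∃ i k j : ι, i ≠ k ∧ P = varMatrix ι i j * varMatrix ι k j}

theorem isMagicUnitary_iff {B : Type*} [Ring B] [StarRing B] [Algebra ℂ B] [StarModule ℂ B]
    (φ : FreeStarAlgebra (ι × ι) →⋆ₐ[ℂ] B) :
    (∀ P ∈ magicRelations ι, φ P = 0) ↔ IsMagicUnitary ((varMatrix ι).map φ) := by
  constructor
  · intro h
    refine ⟨fun i j => ?_, fun i j => ?_, fun i => ?_, fun j => ?_, fun i j k hn => ?_,
      fun i k j hn => ?_⟩
    · have := h _ (Or.inl (Or.inl (Or.inl (Or.inl (Or.inl ⟨i, j, rfl⟩)))))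
      rwa [map_sub, map_star, sub_eq_zero] at this
    · have := h _ (Or.inl (Or.inl (Or.inl (Or.inl (Or.inr ⟨i, j, rfl⟩)))))
      rwa [map_sub, map_mul, sub_eq_zero] at this
    · have := h _ (Or.inl (Or.inl (Or.inl (Or.inr ⟨i, rfl⟩))))
      rwa [map_sub, map_sum, map_one, sub_eq_zero] at this
    · have := h _ (Or.inl (Or.inl (Or.inr ⟨j, rfl⟩)))
      rwa [map_sub, map_sum, map_one, sub_eq_zero] at this
    · have := h _ (Or.inl (Or.inr ⟨i, j, k, hn, rfl⟩))
      rwa [map_mul] at this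
    · have := h _ (Or.inr ⟨i, k, j, hn, rfl⟩)
      rwa [map_mul] at this
  · rintro h P (((((⟨i, j, rfl⟩ | ⟨i, j, rfl⟩) | ⟨i, rfl⟩) | ⟨j, rfl⟩) | ⟨i, j, k, hn, rfl⟩) |
      ⟨i, k, j, hn, rfl⟩)
    · rw [map_sub, map_star, sub_eq_zero]; exact h.star_eq i j
    · rw [map_sub, map_mul, sub_eq_zero]; exact h.idem i j
    · rw [map_sub, map_sum, map_one, sub_eq_zero]; exact h.row_sum i
    · rw [map_sub, map_sum, map_one, sub_eq_zero]; exact h.col_sum j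
    · rw [map_mul]; exact h.row_orth i j k hn
    · rw [map_mul]; exact h.col_orth i k j hn

variable {A B : Type*} [Ring A] [StarRing A] [Algebra ℂ A] [StarModule ℂ A]
  [Ring B] [StarRing B] [Algebra ℂ B] [StarModule ℂ B]

theorem IsMagicUnitary.mul_row [DecidableEq ι] {u : Matrix ι ι A} (h : IsMagicUnitary u)
    (i j k : ι) : u i j * u i k = if j = k then u i j else 0 := by
  split_ifs with hjk
  · rw [← hjk, h.idem]
  · exact h.row_orth i j k hjk

theorem IsMagicUnitary.mul_col [DecidableEq ι] {u : Matrix ι ι A} (h : IsMagicUnitary u)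
    (i k j : ι) : u i j * u k j = if i = k then u i j else 0 := by
  split_ifs with hik
  · rw [← hik, h.idem]
  · exact h.col_orth i k j hik

/-- The matrix with entries `∑ k, u i k ⊗ v k j`. -/
noncomputable def Matrix.tensorMul (u : Matrix ι ι A) (v : Matrix ι ι B) :
    Matrix ι ι (A ⊗[ℂ] B) :=
  fun i j => ∑ k, u i k ⊗ₜ[ℂ] v k j

theorem IsMagicUnitary.tensorMul {u : Matrix ι ι A} {v : Matrix ι ι B} (hu : IsMagicUnitary u)
    (hv : IsMagicUnitary v) : IsMagicUnitary (u.tensorMul v) := by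
  classical
  have hrow : ∀ i j k, u.tensorMul v i j * u.tensorMul v i k
      = ∑ l, u i l ⊗ₜ[ℂ] (v l j * v l k) := fun i j k => by
    simp only [Matrix.tensorMul, Finset.sum_mul_sum, Algebra.TensorProduct.tmul_mul_tmul,
      hu.mul_row, TensorProduct.ite_tmul, Finset.sum_ite_eq, Finset.mem_univ, if_true]
  have hcol : ∀ i k j, u.tensorMul v i j * u.tensorMul v k j
      = ∑ l, (u i l * u k l) ⊗ₜ[ℂ] v l j := fun i k j => by
    simp only [Matrix.tensorMul, Finset.sum_mul_sum, Algebra.TensorProduct.tmul_mul_tmul,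
      hv.mul_col, TensorProduct.tmul_ite, Finset.sum_ite_eq, Finset.mem_univ, if_true]
  refine ⟨fun i j => ?_, fun i j => ?_, fun i => ?_, fun j => ?_, fun i j k hn => ?_,
      fun i k j hn => ?_⟩
  · simp [Matrix.tensorMul, star_sum, hu.star_eq, hv.star_eq]
  · rw [hrow]; simp [hv.idem, Matrix.tensorMul]
  · simp only [Matrix.tensorMul]
    rw [Finset.sum_comm]
    simp [← TensorProduct.tmul_sum, ← TensorProduct.sum_tmul, hu.row_sum, hv.row_sum,
      Algebra.TensorProduct.one_def]
  · simp only [Matrix.tensorMul]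
    rw [Finset.sum_comm]
    simp [← TensorProduct.tmul_sum, ← TensorProduct.sum_tmul, hu.col_sum, hv.col_sum,
      Algebra.TensorProduct.one_def]
  · rw [hrow]; simp [hv.row_orth _ _ _ hn]
  · rw [hcol]; simp [hu.col_orth _ _ _ hn]

theorem IsMagicUnitary.map {u : Matrix ι ι A} (hu : IsMagicUnitary u) (f : A →⋆ₐ[ℂ] B) :
    IsMagicUnitary (u.map f) := by
  refine ⟨fun i j => ?_, fun i j => ?_, fun i => ?_, fun j => ?_, fun i j k hn => ?_,
      fun i k j hn => ?_⟩ <;> simp only [Matrix.map_apply]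
  · rw [← map_star, hu.star_eq]
  · rw [← map_mul, hu.idem]
  · rw [← map_sum, hu.row_sum, map_one]
  · rw [← map_sum, hu.col_sum, map_one]
  · rw [← map_mul, hu.row_orth _ _ _ hn, map_zero]
  · rw [← map_mul, hu.col_orth _ _ _ hn, map_zero]

theorem Matrix.map_tensorMul {C D : Type*} [Ring C] [StarRing C] [Algebra ℂ C] [StarModule ℂ C]
    [Ring D] [StarRing D] [Algebra ℂ D] [StarModule ℂ D]
    (u : Matrix ι ι A) (v : Matrix ι ι B) (f : A →⋆ₐ[ℂ] C) (g : B →⋆ₐ[ℂ] D) (i j : ι) :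
    StarAlgHom.tensorMap f g (u.tensorMul v i j) = (u.map f).tensorMul (v.map g) i j := by
  simp [Matrix.tensorMul]

end magic

/-- A quantum permutation group: a unital complex *-algebra generated by the entries of a magic
unitary `u` (of some nonempty finite size), its fundamental representation, with a comultiplication,
that is, a *-morphism `Δ : A → A ⊗ A` (algebraic tensor product) such that
`Δ (u i j) = ∑ k, u i k ⊗ u k j`. -/
structure QuantumPermutationGroup : Type 1 where
  /-- the index set of the fundamental representation -/
  ι : Type
  [fintype : Fintype ι]
  [nonempty : Nonempty ι]
  /-- the algebra of coefficients -/
  A : Type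
  [ring : Ring A]
  [starRing : StarRing A]
  [algebra : Algebra ℂ A]
  [starModule : StarModule ℂ A]
  /-- the fundamental representation -/
  u : Matrix ι ι A
  magic : IsMagicUnitary u
  generates : StarAlgebra.adjoin ℂ (Set.range fun p : ι × ι => u p.1 p.2) = ⊤
  /-- the comultiplication -/
  comul : A →⋆ₐ[ℂ] A ⊗[ℂ] A
  comul_u : ∀ i j, comul (u i j) = ∑ k, u i k ⊗ₜ[ℂ] u k j

namespace QuantumPermutationGroup

attribute [instance] fintype nonempty ring starRing algebra starModule

/-- Isomorphism of quantum groups: an isomorphism of unital *-algebras which commutes with the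
comultiplications. -/
def Isomorphic (X Y : QuantumPermutationGroup) : Prop :=
  ∃ f : X.A ≃⋆ₐ[ℂ] Y.A, ∀ a,
    Y.comul (f a) = StarAlgHom.tensorMap (f : X.A →⋆ₐ[ℂ] Y.A) (f : X.A →⋆ₐ[ℂ] Y.A) (X.comul a)

/-- The trivial quantum group: the algebra `ℂ`, with fundamental representation `(1)`. -/
noncomputable def trivial : QuantumPermutationGroup where
  ι := Unit
  A := ℂ
  u := 1
  magic := by constructor <;> simp
  generates := eq_top_iff.2 fun c _ => algebraMap_mem _ c
  comul := StarAlgHom.ofId ℂ (ℂ ⊗[ℂ] ℂ)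
  comul_u i j := by simp

/-! ### Quantum permutation groups defined by relations -/

section ofRelations

variable {ι : Type} [Fintype ι] [Nonempty ι]

/-- The generating matrix of the universal *-algebra generated by a magic unitary subject to the
additional relations `R`. -/
noncomputable def genMatrix (R : Set (FreeStarAlgebra (ι × ι))) :
    Matrix ι ι (PresentedStarAlgebra (magicRelations ι ∪ R)) :=
  fun i j => PresentedStarAlgebra.gen _ (i, j)

theorem isMagicUnitary_genMatrix (R : Set (FreeStarAlgebra (ι × ι))) :
    IsMagicUnitary (genMatrix R) :=
  (isMagicUnitary_iff (PresentedStarAlgebra.mk (magicRelations ι ∪ R))).1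
    fun _ hP => PresentedStarAlgebra.mk_eq_zero (Or.inl hP)

/-- The universal *-algebra generated by a magic unitary subject to additional relations `R`
which are preserved by the comultiplication. -/
noncomputable def ofRelations (R : Set (FreeStarAlgebra (ι × ι)))
    (hR : ∀ P ∈ R, FreeStarAlgebra.lift
      (fun p : ι × ι => (genMatrix R).tensorMul (genMatrix R) p.1 p.2) P = 0) :
    QuantumPermutationGroup where
  ι := ι
  A := PresentedStarAlgebra (magicRelations ι ∪ R)
  u := genMatrix R
  magic := isMagicUnitary_genMatrix R
  generates := PresentedStarAlgebra.adjoin_gen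
  comul := PresentedStarAlgebra.lift
    (fun p : ι × ι => (genMatrix R).tensorMul (genMatrix R) p.1 p.2) (by
      rintro P (hP | hP)
      · refine (isMagicUnitary_iff (FreeStarAlgebra.lift _)).2 ?_ P hP
        convert (isMagicUnitary_genMatrix R).tensorMul (isMagicUnitary_genMatrix R) using 1
        ext i j
        simp [varMatrix]
      · exact hR P hP)
  comul_u i j := PresentedStarAlgebra.lift_gen _ _ (i, j)

end ofRelations

/-- The quantum permutation group `S_n^+`: its algebra is the universal *-algebra generated by the
entries of a magic unitary of size `n`. -/
noncomputable def symm (n : ℕ) [NeZero n] : QuantumPermutationGroup :=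
  ofRelations (ι := Fin n) ∅ (by simp)

/-- The fundamental representation of `S_n^+`. -/
noncomputable def symmU (n : ℕ) [NeZero n] : Matrix (Fin n) (Fin n) (symm n).A := (symm n).u

theorem symmU_magic (n : ℕ) [NeZero n] : IsMagicUnitary (symmU n) := (symm n).magic

theorem symm_comul (n : ℕ) [NeZero n] (i j : Fin n) :
    (symm n).comul (symmU n i j) = ∑ k, symmU n i k ⊗ₜ[ℂ] symmU n k j := (symm n).comul_u i j

section graph

variable {V : Type} [Fintype V] [Nonempty V]

open Classical in
/-- The relations which express that the matrix of variables commutes with the adjacency matrix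
of `G`. -/
noncomputable def graphRelations (G : SimpleGraph V) : Set (FreeStarAlgebra (V × V)) :=
  {P | ∃ i j, P = (G.adjMatrix (FreeStarAlgebra (V × V)) * varMatrix V
    - varMatrix V * G.adjMatrix (FreeStarAlgebra (V × V))) i j}

open Classical in
theorem graphRelations_iff (G : SimpleGraph V) {B : Type*} [Ring B] [StarRing B] [Algebra ℂ B]
    [StarModule ℂ B] (φ : FreeStarAlgebra (V × V) →⋆ₐ[ℂ] B) :
    (∀ P ∈ graphRelations G, φ P = 0) ↔
      G.adjMatrix B * (varMatrix V).map φ = (varMatrix V).map φ * G.adjMatrix B := by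
  have key : ∀ i j, φ ((G.adjMatrix (FreeStarAlgebra (V × V)) * varMatrix V
      - varMatrix V * G.adjMatrix (FreeStarAlgebra (V × V))) i j)
      = (G.adjMatrix B * (varMatrix V).map φ) i j - ((varMatrix V).map φ * G.adjMatrix B) i j := by
    intro i j
    simp [Matrix.mul_apply, SimpleGraph.adjMatrix_apply, apply_ite φ]
  constructor
  · intro h
    ext i j
    have := h _ ⟨i, j, rfl⟩
    rwa [key, sub_eq_zero] at this
  · rintro h P ⟨i, j, rfl⟩
    rw [key, h, sub_self]

open Classical in
theorem adjMatrix_tensorMul (G : SimpleGraph V) {B : Type*} [Ring B] [StarRing B] [Algebra ℂ B]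
    [StarModule ℂ B] {u : Matrix V V B} (h : G.adjMatrix B * u = u * G.adjMatrix B) :
    G.adjMatrix (B ⊗[ℂ] B) * u.tensorMul u = u.tensorMul u * G.adjMatrix (B ⊗[ℂ] B) := by
  ext i j
  have h1 : (G.adjMatrix (B ⊗[ℂ] B) * u.tensorMul u) i j
      = ∑ t, (G.adjMatrix B * u) i t ⊗ₜ[ℂ] u t j := by
    simp only [Matrix.mul_apply, SimpleGraph.adjMatrix_apply, Matrix.tensorMul, ite_mul, one_mul,
      zero_mul, TensorProduct.sum_tmul, TensorProduct.ite_tmul]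
    rw [Finset.sum_comm]
    refine Finset.sum_congr rfl fun z _ => ?_
    split_ifs <;> simp
  have h2 : (u.tensorMul u * G.adjMatrix (B ⊗[ℂ] B)) i j
      = ∑ t, u i t ⊗ₜ[ℂ] (u * G.adjMatrix B) t j := by
    simp only [Matrix.mul_apply, SimpleGraph.adjMatrix_apply, Matrix.tensorMul, mul_ite, mul_one,
      mul_zero, TensorProduct.tmul_sum, TensorProduct.tmul_ite]
    rw [Finset.sum_comm]
    refine Finset.sum_congr rfl fun z _ => ?_
    split_ifs <;> simp
  rw [h] at h1
  rw [← h] at h2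
  rw [h1, h2]
  simp only [Matrix.mul_apply, SimpleGraph.adjMatrix_apply, ite_mul, mul_ite, one_mul, mul_one,
    zero_mul, mul_zero, TensorProduct.sum_tmul, TensorProduct.tmul_sum, TensorProduct.ite_tmul,
    TensorProduct.tmul_ite]
  rw [Finset.sum_comm]

/-- The quantum automorphism group of a finite graph `G`: its algebra is the universal *-algebra
generated by the entries of a magic unitary, indexed by the vertices of `G`, which commutes with the
adjacency matrix of `G`. -/
noncomputable def ofGraph (G : SimpleGraph V) : QuantumPermutationGroup :=
  ofRelations (graphRelations G) (by
    classical
    rw [graphRelations_iff]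
    have h := (graphRelations_iff G (PresentedStarAlgebra.mk _)).1
      fun P hP => PresentedStarAlgebra.mk_eq_zero (R := magicRelations V ∪ graphRelations G)
        (Or.inr hP)
    change _ * genMatrix (graphRelations G) = genMatrix (graphRelations G) * _ at h
    set w := genMatrix (graphRelations G)
    have hw : (varMatrix V).map (FreeStarAlgebra.lift
        (fun p : V × V => w.tensorMul w p.1 p.2)) = w.tensorMul w := by
      ext i j
      simp [varMatrix]
    rw [hw]
    exact adjMatrix_tensorMul G h)

end graph

/-! ### Free products -/

section freeProduct

variable (X Y : QuantumPermutationGroup)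

/-- The relations of the unital free product of the algebras of `X` and `Y`: both canonical maps
are morphisms of unital *-algebras. -/
def freeProductRelations : Set (FreeStarAlgebra (X.A ⊕ Y.A)) :=
  homRelations (fun a : X.A => FreeStarAlgebra.of (Sum.inl a)) ∪
  homRelations (fun b : Y.A => FreeStarAlgebra.of (Sum.inr b))

/-- The unital free product of the algebras of `X` and `Y`. -/
abbrev FreeProductAlgebra : Type := PresentedStarAlgebra (freeProductRelations X Y)

/-- The canonical morphism from the first factor to the free product. -/
noncomputable def freeInl : X.A →⋆ₐ[ℂ] FreeProductAlgebra X Y :=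
  homOfRelations (fun a : X.A => FreeStarAlgebra.of (Sum.inl a)) Set.subset_union_left

/-- The canonical morphism from the second factor to the free product. -/
noncomputable def freeInr : Y.A →⋆ₐ[ℂ] FreeProductAlgebra X Y :=
  homOfRelations (fun b : Y.A => FreeStarAlgebra.of (Sum.inr b)) Set.subset_union_right

variable {X Y} in
/-- The universal property of the unital free product. -/
noncomputable def freeLift {B : Type*} [Ring B] [StarRing B] [Algebra ℂ B] [StarModule ℂ B]
    (f : X.A →⋆ₐ[ℂ] B) (g : Y.A →⋆ₐ[ℂ] B) : FreeProductAlgebra X Y →⋆ₐ[ℂ] B :=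
  PresentedStarAlgebra.lift (Sum.elim f g) (by
    rintro P (hP | hP)
    · exact (homRelations_iff (FreeStarAlgebra.lift _)).2 ⟨f, fun a => by simp⟩ P hP
    · exact (homRelations_iff (FreeStarAlgebra.lift _)).2 ⟨g, fun a => by simp⟩ P hP)

variable {X Y} in
@[simp] theorem freeLift_inl {B : Type*} [Ring B] [StarRing B] [Algebra ℂ B] [StarModule ℂ B]
    (f : X.A →⋆ₐ[ℂ] B) (g : Y.A →⋆ₐ[ℂ] B) (a : X.A) : freeLift f g (freeInl X Y a) = f a :=
  PresentedStarAlgebra.lift_gen _ _ (Sum.inl a)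

variable {X Y} in
@[simp] theorem freeLift_inr {B : Type*} [Ring B] [StarRing B] [Algebra ℂ B] [StarModule ℂ B]
    (f : X.A →⋆ₐ[ℂ] B) (g : Y.A →⋆ₐ[ℂ] B) (b : Y.A) : freeLift f g (freeInr X Y b) = g b :=
  PresentedStarAlgebra.lift_gen _ _ (Sum.inr b)

/-- The image of a *-morphism is in a *-subalgebra as soon as the images of the coefficients of the
fundamental representation are. -/
theorem hom_mem {B : Type*} [Ring B] [StarRing B] [Algebra ℂ B] [StarModule ℂ B]
    (f : X.A →⋆ₐ[ℂ] B) (S : StarSubalgebra ℂ B) (h : ∀ i j, f (X.u i j) ∈ S) (a : X.A) :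
    f a ∈ S := by
  have : StarAlgebra.adjoin ℂ (Set.range fun p : X.ι × X.ι => X.u p.1 p.2) ≤ S.comap f :=
    StarAlgebra.adjoin_le (by rintro _ ⟨p, rfl⟩; exact h p.1 p.2)
  rw [X.generates] at this
  exact this (show a ∈ (⊤ : StarSubalgebra ℂ X.A) from _root_.trivial)

/-- The free product of two quantum permutation groups: its algebra is the unital free product of
the algebras, and its fundamental representation is the block diagonal matrix formed by
the fundamental representations. -/
noncomputable def freeProduct : QuantumPermutationGroup where
  ι := X.ι ⊕ Y.ι
  A := FreeProductAlgebra X Y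
  u := Matrix.fromBlocks (X.u.map (freeInl X Y)) 0 0 (Y.u.map (freeInr X Y))
  magic := by
    have hX := X.magic.map (freeInl X Y)
    have hY := Y.magic.map (freeInr X Y)
    refine ⟨?_, ?_, ?_, ?_, ?_, ?_⟩
    · rintro (i | i) (j | j)
      · exact hX.star_eq i j
      · simp
      · simp
      · exact hY.star_eq i j
    · rintro (i | i) (j | j)
      · exact hX.idem i j
      · simp
      · simp
      · exact hY.idem i j
    · rintro (i | i)
      · simpa [Fintype.sum_sum_type] using hX.row_sum i
      · simpa [Fintype.sum_sum_type] using hY.row_sum i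
    · rintro (i | i)
      · simpa [Fintype.sum_sum_type] using hX.col_sum i
      · simpa [Fintype.sum_sum_type] using hY.col_sum i
    · rintro (i | i) (j | j) (k | k) hn
      · exact hX.row_orth i j k fun h => hn (congrArg _ h)
      all_goals try simp
      exact hY.row_orth i j k fun h => hn (congrArg _ h)
    · rintro (i | i) (k | k) (j | j) hn
      · exact hX.col_orth i k j fun h => hn (congrArg _ h)
      all_goals try simp
      exact hY.col_orth i k j fun h => hn (congrArg _ h)
  generates := by
    rw [eq_top_iff, ← PresentedStarAlgebra.adjoin_gen]
    refine StarAlgebra.adjoin_le ?_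
    rintro _ ⟨a | b, rfl⟩
    · refine hom_mem X (freeInl X Y) _ (fun i j => ?_) a
      exact StarAlgebra.subset_adjoin ℂ _ ⟨(Sum.inl i, Sum.inl j), rfl⟩
    · refine hom_mem Y (freeInr X Y) _ (fun i j => ?_) b
      exact StarAlgebra.subset_adjoin ℂ _ ⟨(Sum.inr i, Sum.inr j), rfl⟩
  comul := freeLift
    ((StarAlgHom.tensorMap (freeInl X Y) (freeInl X Y)).comp X.comul)
    ((StarAlgHom.tensorMap (freeInr X Y) (freeInr X Y)).comp Y.comul)
  comul_u := by
    rintro (i | i) (j | j) <;> simp [Fintype.sum_sum_type, X.comul_u, Y.comul_u]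

end freeProduct

/-! ### Wreath products -/

section wreath

variable (X : QuantumPermutationGroup) (n : ℕ) [NeZero n]

/-- The relations of the algebra of the wreath product of `X` by `S_n^+`, generated by `n` copies of
the algebra of `X` and one copy of the algebra of `S_n^+`: the canonical maps are morphisms of unital
*-algebras, and the `i`-th copy of the algebra of `X` commutes with the `i`-th row of
the fundamental representation of `S_n^+`. -/
def wreathRelations : Set (FreeStarAlgebra ((Fin n × X.A) ⊕ (symm n).A)) :=
  (⋃ i : Fin n, homRelations (fun a : X.A => FreeStarAlgebra.of (Sum.inl (i, a)))) ∪
  homRelations (fun b : (symm n).A => FreeStarAlgebra.of (Sum.inr b)) ∪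
  {P | ∃ (i j : Fin n) (a : X.A), P =
    FreeStarAlgebra.of (Sum.inl (i, a)) * FreeStarAlgebra.of (Sum.inr (symmU n i j)) -
    FreeStarAlgebra.of (Sum.inr (symmU n i j)) * FreeStarAlgebra.of (Sum.inl (i, a))}

/-- The algebra of the wreath product of `X` by `S_n^+`. -/
abbrev WreathAlgebra : Type := PresentedStarAlgebra (wreathRelations X n)

/-- The canonical morphism from the `i`-th copy of the algebra of `X`. -/
noncomputable def wreathNu (i : Fin n) : X.A →⋆ₐ[ℂ] WreathAlgebra X n :=
  homOfRelations (fun a : X.A => FreeStarAlgebra.of (Sum.inl (i, a)))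
    (fun _ hP => Or.inl (Or.inl (Set.mem_iUnion.2 ⟨i, hP⟩)))

/-- The canonical morphism from the algebra of `S_n^+`. -/
noncomputable def wreathSymm : (symm n).A →⋆ₐ[ℂ] WreathAlgebra X n :=
  homOfRelations (fun b : (symm n).A => FreeStarAlgebra.of (Sum.inr b))
    (fun _ hP => Or.inl (Or.inr hP))

/-- The image of the fundamental representation of `S_n^+` in the algebra of the wreath product. -/
noncomputable def wreathP : Matrix (Fin n) (Fin n) (WreathAlgebra X n) :=
  fun i j => wreathSymm X n (symmU n i j)

theorem wreathP_magic : IsMagicUnitary (wreathP X n) :=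
  (symmU_magic n).map (wreathSymm X n)

theorem wreath_comm (i j : Fin n) (a : X.A) :
    Commute (wreathNu X n i a) (wreathP X n i j) := by
  have h := PresentedStarAlgebra.mk_eq_zero (R := wreathRelations X n)
    (Or.inr ⟨i, j, a, rfl⟩)
  rw [map_sub, map_mul, map_mul, sub_eq_zero] at h
  exact h

variable {X n} in
/-- The universal property of the algebra of the wreath product. -/
noncomputable def wreathLift {B : Type*} [Ring B] [StarRing B] [Algebra ℂ B] [StarModule ℂ B]
    (f : Fin n → X.A →⋆ₐ[ℂ] B) (g : (symm n).A →⋆ₐ[ℂ] B)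
    (h : ∀ i j a, Commute (f i a) (g (symmU n i j))) : WreathAlgebra X n →⋆ₐ[ℂ] B :=
  PresentedStarAlgebra.lift (Sum.elim (fun p => f p.1 p.2) g) (by
    rintro P ((hP | hP) | ⟨i, j, a, rfl⟩)
    · obtain ⟨i, hP⟩ := Set.mem_iUnion.1 hP
      exact (homRelations_iff (FreeStarAlgebra.lift _)).2 ⟨f i, fun a => by simp⟩ P hP
    · exact (homRelations_iff (FreeStarAlgebra.lift _)).2 ⟨g, fun a => by simp⟩ P hP
    · rw [map_sub, map_mul, map_mul, sub_eq_zero]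
      simpa using (h i j a).eq)

section lift

variable {B : Type*} [Ring B] [StarRing B] [Algebra ℂ B] [StarModule ℂ B]
    (f : Fin n → X.A →⋆ₐ[ℂ] B) (g : (symm n).A →⋆ₐ[ℂ] B)
    (h : ∀ i j a, Commute (f i a) (g (symmU n i j)))

@[simp] theorem wreathLift_nu (i : Fin n) (a : X.A) :
    wreathLift f g h (wreathNu X n i a) = f i a :=
  PresentedStarAlgebra.lift_gen _ _ (Sum.inl (i, a))

@[simp] theorem wreathLift_symm (b : (symm n).A) :
    wreathLift f g h (wreathSymm X n b) = g b :=
  PresentedStarAlgebra.lift_gen _ _ (Sum.inr b)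

end lift

theorem wreath_comm_tensor (i j k : Fin n) (x : X.A ⊗[ℂ] X.A)
    (t : WreathAlgebra X n) (ht : ∀ a, Commute (wreathNu X n k a) t) :
    Commute (StarAlgHom.tensorMap (wreathNu X n i) (wreathNu X n k) x)
      (wreathP X n i j ⊗ₜ[ℂ] t) := by
  induction x using TensorProduct.induction_on with
  | zero => rw [map_zero]; exact Commute.zero_left _
  | tmul a b =>
    rw [StarAlgHom.tensorMap_tmul]
    change _ * _ = _ * _
    rw [Algebra.TensorProduct.tmul_mul_tmul, Algebra.TensorProduct.tmul_mul_tmul,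
      (wreath_comm X n i j a).eq, (ht b).eq]
  | add x y hx hy => rw [map_add]; exact hx.add_left hy

/-- The comultiplication of the wreath product on the `i`-th copy of the algebra of `X`:
`ν_i (a) ↦ ∑ k, (ν_i ⊗ ν_k) (Δ a) (p i k ⊗ 1)`. -/
noncomputable def wreathComulNu (i : Fin n) :
    X.A →⋆ₐ[ℂ] WreathAlgebra X n ⊗[ℂ] WreathAlgebra X n :=
  have hc : ∀ (k l : Fin n) x, Commute (StarAlgHom.tensorMap (wreathNu X n i) (wreathNu X n k) x)
      (wreathP X n i l ⊗ₜ[ℂ] (1 : WreathAlgebra X n)) :=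
    fun k l x => wreath_comm_tensor X n i l k x 1 fun _ => Commute.one_right _
  have hsum : ∑ k, wreathP X n i k ⊗ₜ[ℂ] (1 : WreathAlgebra X n) = 1 := by
    rw [← TensorProduct.sum_tmul, (wreathP_magic X n).row_sum]; rfl
  have hsc : ∀ c : ℂ, ∑ k, StarAlgHom.tensorMap (wreathNu X n i) (wreathNu X n k)
      (X.comul (algebraMap ℂ X.A c)) * (wreathP X n i k ⊗ₜ[ℂ] (1 : WreathAlgebra X n))
      = algebraMap ℂ _ c := fun c => by
    simp only [AlgHomClass.commutes]
    rw [← Finset.mul_sum, hsum, mul_one]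
  { toFun := fun a => ∑ k, StarAlgHom.tensorMap (wreathNu X n i) (wreathNu X n k) (X.comul a) *
      (wreathP X n i k ⊗ₜ[ℂ] (1 : WreathAlgebra X n))
    map_one' := by simpa only [map_one] using hsc 1
    map_zero' := by simp
    map_add' := fun a b => by simp [add_mul, Finset.sum_add_distrib]
    commutes' := hsc
    map_mul' := fun a b => by
      rw [Finset.sum_mul_sum]
      refine Finset.sum_congr rfl fun k _ => ?_
      rw [Finset.sum_eq_single k]
      · rw [mul_assoc, ← mul_assoc (wreathP X n i k ⊗ₜ[ℂ] (1 : WreathAlgebra X n)),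
          ← (hc k k _).eq, mul_assoc, ← mul_assoc, ← map_mul, ← map_mul,
          Algebra.TensorProduct.tmul_mul_tmul, (wreathP_magic X n).idem, one_mul]
      · intro l _ hl
        rw [mul_assoc, ← mul_assoc (wreathP X n i k ⊗ₜ[ℂ] (1 : WreathAlgebra X n)),
          ← (hc l k _).eq, mul_assoc, Algebra.TensorProduct.tmul_mul_tmul,
          (wreathP_magic X n).row_orth _ _ _ hl.symm, TensorProduct.zero_tmul, mul_zero, mul_zero]
      · simp
    map_star' := fun a => by
      rw [star_sum]
      refine Finset.sum_congr rfl fun k _ => ?_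
      rw [star_mul, TensorProduct.star_tmul, (wreathP_magic X n).star_eq, star_one, map_star,
        map_star, ← map_star, (hc k k _).eq] }

theorem wreathComulNu_apply (i : Fin n) (a : X.A) : wreathComulNu X n i a =
    ∑ k, StarAlgHom.tensorMap (wreathNu X n i) (wreathNu X n k) (X.comul a) *
      (wreathP X n i k ⊗ₜ[ℂ] (1 : WreathAlgebra X n)) := rfl

/-- The comultiplication of the wreath product on the algebra of `S_n^+`:
`p i j ↦ ∑ k, p i k ⊗ p k j`. -/
noncomputable def wreathComulSymm :
    (symm n).A →⋆ₐ[ℂ] WreathAlgebra X n ⊗[ℂ] WreathAlgebra X n :=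
  (StarAlgHom.tensorMap (wreathSymm X n) (wreathSymm X n)).comp (symm n).comul

theorem wreathComulSymm_u (i j : Fin n) : wreathComulSymm X n (symmU n i j)
    = ∑ k, wreathP X n i k ⊗ₜ[ℂ] wreathP X n k j := by
  rw [wreathComulSymm, StarAlgHom.comp_apply, symm_comul, map_sum]
  rfl

theorem wreathComul_mul (i j : Fin n) (a : X.A) :
    wreathComulNu X n i a * wreathComulSymm X n (symmU n i j) =
    ∑ k, StarAlgHom.tensorMap (wreathNu X n i) (wreathNu X n k) (X.comul a) *
      (wreathP X n i k ⊗ₜ[ℂ] wreathP X n k j) := by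
  rw [wreathComulNu_apply, wreathComulSymm_u, Finset.sum_mul_sum]
  refine Finset.sum_congr rfl fun k _ => ?_
  rw [Finset.sum_eq_single k]
  · rw [mul_assoc, Algebra.TensorProduct.tmul_mul_tmul, (wreathP_magic X n).idem, one_mul]
  · intro l _ hl
    rw [mul_assoc, Algebra.TensorProduct.tmul_mul_tmul,
      (wreathP_magic X n).row_orth _ _ _ hl.symm, TensorProduct.zero_tmul, mul_zero]
  · simp

theorem wreathComul_comm (i j : Fin n) (a : X.A) :
    Commute (wreathComulNu X n i a) (wreathComulSymm X n (symmU n i j)) := by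
  change _ * _ = _ * _
  rw [wreathComul_mul, wreathComulNu_apply, wreathComulSymm_u, Finset.sum_mul_sum, Finset.sum_comm]
  refine Finset.sum_congr rfl fun k _ => ?_
  rw [Finset.sum_eq_single k]
  · rw [← mul_assoc, ← (wreath_comm_tensor X n i k k _ _ fun a => wreath_comm X n k j a).eq,
      mul_assoc, Algebra.TensorProduct.tmul_mul_tmul, (wreathP_magic X n).idem, mul_one]
  · intro l _ hl
    rw [(wreath_comm_tensor X n i k k _ 1 fun _ => Commute.one_right _).eq, ← mul_assoc,
      Algebra.TensorProduct.tmul_mul_tmul, (wreathP_magic X n).row_orth _ _ _ hl,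
      TensorProduct.zero_tmul, zero_mul]
  · simp

/-- The wreath product of `X` by `S_n^+`: its algebra is the quotient of the unital free product of
`n` copies of the algebra of `X` and of the algebra of `S_n^+` by the relations
`ν_i (a) p i j = p i j ν_i (a)`, and its fundamental representation has entry `ν_i (u k l) p i j` in
row `(i, k)` and column `(j, l)`. -/
noncomputable def wreath : QuantumPermutationGroup where
  ι := Fin n × X.ι
  A := WreathAlgebra X n
  u := fun r c => wreathNu X n r.1 (X.u r.2 c.2) * wreathP X n r.1 c.1
  magic := by
    have hP := wreathP_magic X n
    have hU := fun i => X.magic.map (wreathNu X n i)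
    have hc := wreath_comm X n
    refine ⟨?_, ?_, ?_, ?_, ?_, ?_⟩
    · rintro ⟨i, k⟩ ⟨j, l⟩
      rw [star_mul, hP.star_eq, ← map_star, X.magic.star_eq, (hc i j _).eq]
    · rintro ⟨i, k⟩ ⟨j, l⟩
      rw [(hc i j _).symm.mul_mul_mul_comm, hP.idem, ← map_mul, X.magic.idem]
    · rintro ⟨i, k⟩
      rw [Fintype.sum_prod_type]
      simp only [← Finset.sum_mul, ← map_sum, X.magic.row_sum, map_one, one_mul, hP.row_sum]
    · rintro ⟨j, l⟩
      rw [Fintype.sum_prod_type]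
      simp only [← Finset.sum_mul, ← map_sum, X.magic.col_sum, map_one, one_mul, hP.col_sum]
    · rintro ⟨i, k⟩ ⟨j, l⟩ ⟨j', l'⟩ hn
      rw [(hc i j _).symm.mul_mul_mul_comm]
      by_cases hj : j = j'
      · rw [← map_mul, X.magic.row_orth k l l' fun hl => hn (by rw [hj, hl]), map_zero, zero_mul]
      · rw [hP.row_orth i j j' hj, mul_zero]
    · rintro ⟨i, k⟩ ⟨i', k'⟩ ⟨j, l⟩ hn
      by_cases hi : i = i'
      · subst hi
        rw [(hc i j _).symm.mul_mul_mul_comm, ← map_mul,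
          X.magic.col_orth k k' l fun hk => hn (by rw [hk]), map_zero, zero_mul]
      · rw [(hc i' j _).eq, mul_assoc, ← mul_assoc (wreathP X n i j), hP.col_orth i i' j hi,
          zero_mul, mul_zero]
  generates := by
    rw [eq_top_iff, ← PresentedStarAlgebra.adjoin_gen]
    refine StarAlgebra.adjoin_le ?_
    have hmem : ∀ i k j l, wreathNu X n i (X.u k l) * wreathP X n i j ∈
        StarAlgebra.adjoin ℂ (Set.range fun p : (Fin n × X.ι) × (Fin n × X.ι) =>
          wreathNu X n p.1.1 (X.u p.1.2 p.2.2) * wreathP X n p.1.1 p.2.1) :=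
      fun i k j l => StarAlgebra.subset_adjoin ℂ _ ⟨((i, k), (j, l)), rfl⟩
    rintro _ ⟨⟨i, a⟩ | b, rfl⟩
    · refine hom_mem X (wreathNu X n i) _ (fun k l => ?_) a
      have := sum_mem (t := Finset.univ) fun j _ => hmem i k j l
      rwa [← Finset.mul_sum, (wreathP_magic X n).row_sum, mul_one] at this
    · refine hom_mem (symm n) (wreathSymm X n) _ (fun i j => ?_) b
      obtain ⟨k⟩ := X.nonempty
      have := sum_mem (t := Finset.univ) fun l _ => hmem i k j l
      rwa [← Finset.sum_mul, ← map_sum, X.magic.row_sum, map_one, one_mul] at this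
  comul := wreathLift (wreathComulNu X n) (wreathComulSymm X n) (wreathComul_comm X n)
  comul_u := by
    rintro ⟨i, k⟩ ⟨j, l⟩
    rw [map_mul, wreathLift_nu, wreathP, wreathLift_symm, wreathComul_mul]
    refine Eq.trans ?_ (Fintype.sum_prod_type _).symm
    refine Finset.sum_congr rfl fun t _ => ?_
    rw [X.comul_u, map_sum, Finset.sum_mul]
    exact Finset.sum_congr rfl fun r _ => Algebra.TensorProduct.tmul_mul_tmul _ _ _ _

end wreath

/-! ### Families of quantum permutation groups -/

/-- A family of quantum permutation groups, considered up to isomorphism, which contains the trivial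
quantum group and is closed under free products and under wreath products with `S_n^+` for
every `n ≥ 1`. -/
structure IsJordanFamily (I : Set QuantumPermutationGroup) : Prop where
  isomorphic_mem : ∀ X Y, X.Isomorphic Y → X ∈ I → Y ∈ I
  trivial_mem : trivial ∈ I
  freeProduct_mem : ∀ X Y, X ∈ I → Y ∈ I → freeProduct X Y ∈ I
  wreath_mem : ∀ X ∈ I, ∀ (n : ℕ) [NeZero n], wreath X n ∈ I

/-- The family of quantum automorphism groups of finite trees, up to isomorphism. -/
def treeFamily : Set QuantumPermutationGroup :=
  {X | ∃ (V : Type) (_ : Fintype V) (_ : Nonempty V) (T : SimpleGraph V),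
    T.IsTree ∧ (ofGraph T).Isomorphic X}

end QuantumPermutationGroup

/-! ## Colourings preserved by a magic unitary -/

/-! Commuting with an adjacency matrix is the same as preserving adjacency, seen as a colouring of
the pairs of vertices (`Preserves.adj_iff`). Preserved colourings are closed under Boolean
operations, transposition, matrix products and counting (`Preserves.matrix_mul`, `Preserves.card`),
so whatever is definable from adjacency in these terms is preserved as well. Two structures
definable from each other are preserved by the same magic unitaries, hence have the same quantum
automorphism group (`IsAutomorphismGroup.congr`). The problem thus becomes one of combinatorics.

From trees to the closure: in a tree, the sum of the distances to all vertices is strictly convex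
along paths. Orienting the edges in the direction of decrease gives a rooted forest, whose roots are
pairwise adjacent in the tree, and this forest and the tree are definable from each other
(`SimpleGraph.IsTree.adj_iff_medianRel`). A rooted forest is then dismantled by induction. A unique
root can be deleted, which does not change the quantum group; a forest of several isomorphic trees
gives a wreath product; otherwise the trees of one shape are split off, which gives a free product.
The last case rests on `SameShape.eq_zero_of_not`: the entry `u i j` vanishes unless the subtrees
below `i` and `j` are isomorphic.

From the closure to trees: every member is the quantum automorphism group of a rooted tree
(`HasForest.of_jordanClosure`). Adding a root is a free product with the trivial quantum group, so
sizes can be adjusted at no cost until the two factors of a free product are told apart by size;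
copies of a tree realise wreath products. To forget the root, two paths of comparable size are put
beside the tree and everything is joined to a new root. Each branch then has less than half of the
vertices, so the orientation towards the root is recovered from the distance sums
(`IsForest.distSum_lt`). -/

/-- A magic unitary `u` preserves a colouring `c` of the pairs of indices if
`u i k * u j l = 0` whenever the pairs `(i, j)` and `(k, l)` have distinct colours. -/
def Preserves {V K A : Type*} [Ring A] (u : Matrix V V A) (c : V → V → K) : Prop :=
  ∀ i j k l, c i j ≠ c k l → u i k * u j l = 0

namespace Preserves

variable {V : Type} [Fintype V] {A : Type*} [Ring A] [StarRing A] [Algebra ℂ A] [StarModule ℂ A]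
  {u : Matrix V V A} {K L : Type*} {c : V → V → K} {d : V → V → L}

theorem comp (h : Preserves u c) (f : K → L) : Preserves u fun i j => f (c i j) :=
  fun i j k l hn => h i j k l fun e => hn (congrArg f e)

/-- A colouring which is a function of two preserved colourings is preserved. -/
theorem of_eq {M : Type*} {e : V → V → M} (h : Preserves u c) (h' : Preserves u d)
    (he : ∀ i j k l, c i j = c k l → d i j = d k l → e i j = e k l) : Preserves u e :=
  fun i j k l hn => by
    by_cases e₁ : c i j = c k l
    · exact h' i j k l fun e₂ => hn (he i j k l e₁ e₂)
    · exact h i j k l e₁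

theorem prodMk (h : Preserves u c) (h' : Preserves u d) :
    Preserves u fun i j => (c i j, d i j) :=
  h.of_eq h' fun _ _ _ _ h₁ h₂ => Prod.ext h₁ h₂

theorem const (a : K) : Preserves u fun _ _ => a := fun _ _ _ _ hn => (hn rfl).elim

theorem swap (hu : IsMagicUnitary u) (h : Preserves u c) : Preserves u fun i j => c j i :=
  fun i j k l hn => by
    have := congrArg star (h j i l k hn)
    rwa [star_mul, star_zero, hu.star_eq, hu.star_eq] at this

theorem eq (hu : IsMagicUnitary u) : Preserves u (Eq : V → V → Prop) := fun i j k l hn => by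
  by_cases hij : i = j
  · subst hij
    exact hu.row_orth i k l fun e => hn (by simp [e])
  · by_cases hkl : k = l
    · subst hkl
      exact hu.col_orth i j k hij
    · exact (hn (by simp [hij, hkl])).elim

theorem not {R : V → V → Prop} (h : Preserves u R) : Preserves u fun i j => ¬ R i j := h.comp Not

theorem and {R S : V → V → Prop} (h : Preserves u R) (h' : Preserves u S) :
    Preserves u fun i j => R i j ∧ S i j :=
  h.of_eq h' fun _ _ _ _ h₁ h₂ => by rw [h₁, h₂]

theorem or {R S : V → V → Prop} (h : Preserves u R) (h' : Preserves u S) :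
    Preserves u fun i j => R i j ∨ S i j :=
  h.of_eq h' fun _ _ _ _ h₁ h₂ => by rw [h₁, h₂]

theorem iExists {ι : Sort*} {R : ι → V → V → Prop} (h : ∀ n, Preserves u (R n)) :
    Preserves u fun i j => ∃ n, R n i j := fun i j k l hn => by
  by_contra h0
  exact hn (propext (exists_congr fun n => Iff.of_eq (not_not.1 (mt (h n i j k l) h0))))

theorem smul_eq {M : Matrix V V ℂ} (h : Preserves u M) (i j k l : V) :
    M i j • (u i k * u j l) = M k l • (u i k * u j l) := by
  by_cases e : M i j = M k l
  · rw [e]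
  · rw [h i j k l e, smul_zero, smul_zero]

/-- Insert `1 = ∑ s, u t s`, or `1 = ∑ t, u t s`, between `u i k` and `u j l`. A nonzero product `u
i k * u t s * u j l` forces `M i t = M k s` and `N t j = N s l`, so the double sums weighted by `M i
t * N t j` and by `M k s * N s l` agree. They evaluate to `(M * N) i j` and `(M * N) k l` times `u i
k * u j l`. -/
theorem matrix_mul (hu : IsMagicUnitary u) {M N : Matrix V V ℂ} (h : Preserves u M)
    (h' : Preserves u N) : Preserves u (M * N) := fun i j k l hn => by
  have key : ∀ t s, (M i t * N t j) • (u i k * u t s * u j l)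
      = (M k s * N s l) • (u i k * u t s * u j l) := fun t s => by
    have h1 := congrArg (· * u j l) (h.smul_eq i t k s)
    have h2 := congrArg (u i k * ·) (h'.smul_eq t j s l)
    simp only [smul_mul_assoc, mul_smul_comm, ← mul_assoc] at h1 h2
    rw [mul_smul, h2, smul_comm, h1, smul_comm, ← mul_smul]
  have h1 : (M * N) i j • (u i k * u j l) = ∑ t, ∑ s, (M i t * N t j) • (u i k * u t s * u j l) := by
    simp_rw [← Finset.smul_sum, ← Finset.sum_mul, ← Finset.mul_sum, hu.row_sum, mul_one,
      ← Finset.sum_smul, Matrix.mul_apply]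
  have h2 : (M * N) k l • (u i k * u j l) = ∑ s, ∑ t, (M k s * N s l) • (u i k * u t s * u j l) := by
    simp_rw [← Finset.smul_sum, ← Finset.sum_mul, ← Finset.mul_sum, hu.col_sum, mul_one,
      ← Finset.sum_smul, Matrix.mul_apply]
  rw [Finset.sum_comm] at h2
  simp_rw [key] at h1
  have h3 := h1.trans h2.symm
  rw [← sub_eq_zero, ← sub_smul] at h3
  exact (smul_eq_zero_iff_right (sub_ne_zero.2 hn)).1 h3

-- The number of intermediate points is an entry of the product of two 0/1 matrices, and distinct
-- naturals stay distinct in `ℂ`.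
open Classical in
theorem card (hu : IsMagicUnitary u) {R S : V → V → Prop} (h : Preserves u R)
    (h' : Preserves u S) :
    Preserves u fun i j => (Finset.univ.filter fun k => R i k ∧ S k j).card := by
  have h1 := matrix_mul hu (M := fun i j => if R i j then 1 else 0)
    (N := fun i j => if S i j then 1 else 0) (h.comp fun p => if p then (1 : ℂ) else 0)
    (h'.comp fun p => if p then (1 : ℂ) else 0)
  intro i j k l hn
  refine h1 i j k l fun e => hn ?_
  replace e : ∑ t, (if R i t then (1 : ℂ) else 0) * (if S t j then (1 : ℂ) else 0)
      = ∑ t, (if R k t then (1 : ℂ) else 0) * (if S t l then (1 : ℂ) else 0) := e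
  simp only [ite_mul, one_mul, zero_mul, ← ite_and, Finset.sum_boole] at e
  exact_mod_cast e

theorem relComp (hu : IsMagicUnitary u) {R S : V → V → Prop} (h : Preserves u R)
    (h' : Preserves u S) : Preserves u fun i j => ∃ k, R i k ∧ S k j := by
  classical
  have := (h.card hu h').comp (fun n => 0 < n)
  simpa [Finset.card_pos, Finset.filter_nonempty_iff] using this

/-- The `n`-th power of a relation. -/
def relPow (R : V → V → Prop) : ℕ → V → V → Prop
  | 0 => Eq
  | n + 1 => fun i j => ∃ k, relPow R n i k ∧ R k j

theorem relPow_preserves (hu : IsMagicUnitary u) {R : V → V → Prop} (h : Preserves u R) (n : ℕ) :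
    Preserves u (relPow R n) := by
  induction n with
  | zero => exact eq hu
  | succ n ih => exact ih.relComp hu h

theorem reflTransGen_iff_relPow {R : V → V → Prop} {i j : V} :
    Relation.ReflTransGen R i j ↔ ∃ n, relPow R n i j := by
  constructor
  · intro h
    induction h with
    | refl => exact ⟨0, rfl⟩
    | tail _ h ih => obtain ⟨n, hn⟩ := ih; exact ⟨n + 1, _, hn, h⟩
  · rintro ⟨n, hn⟩
    induction n generalizing j with
    | zero => exact hn ▸ .refl
    | succ n ih => obtain ⟨k, hk, h⟩ := hn; exact (ih hk).tail h

theorem reflTransGen (hu : IsMagicUnitary u) {R : V → V → Prop} (h : Preserves u R) :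
    Preserves u (Relation.ReflTransGen R) := by
  have := iExists (relPow_preserves hu h)
  simpa only [← reflTransGen_iff_relPow] using this

/-- An entry is idempotent, so it is the product attached to the diagonal pairs `(i, i)` and `(k,
k)`. -/
theorem eq_zero_of_ne (hu : IsMagicUnitary u) (h : Preserves u c) {i k : V}
    (hn : c i i ≠ c k k) : u i k = 0 := by
  rw [← hu.idem]; exact h i i k k hn

theorem of_eq_zero {f : V → K} (h : ∀ i k, f i ≠ f k → u i k = 0) :
    Preserves u fun i _ => f i := fun i j k l hn => by rw [h i k hn, zero_mul]

theorem map {B : Type*} [Ring B] [StarRing B] [Algebra ℂ B] [StarModule ℂ B] (h : Preserves u c)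
    (f : A →⋆ₐ[ℂ] B) : Preserves (u.map f) c := fun i j k l hn => by
  rw [Matrix.map_apply, Matrix.map_apply, ← map_mul, h i j k l hn, map_zero]

theorem submatrix {W : Type} (h : Preserves u c) (e : W → V) :
    Preserves (u.submatrix e e) fun i j => c (e i) (e j) := fun _ _ _ _ hn => h _ _ _ _ hn

-- Both products with the adjacency matrix expand into double sums of the `u i k * u j l`, weighted
-- by adjacency of `(i, j)` or of `(k, l)`; preservation makes the weights agree on nonzero terms.
open Classical in
theorem adj_iff (hu : IsMagicUnitary u) (G : SimpleGraph V) :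
    Preserves u G.Adj ↔ G.adjMatrix A * u = u * G.adjMatrix A := by
  constructor
  · intro h
    ext i l
    have h1 : (G.adjMatrix A * u) i l
        = ∑ j, ∑ k, (if G.Adj i j then (1 : ℂ) else 0) • (u i k * u j l) := by
      simp_rw [← Finset.smul_sum, ← Finset.sum_mul, hu.row_sum, one_mul, Matrix.mul_apply,
        SimpleGraph.adjMatrix_apply, ite_mul, one_mul, zero_mul, ite_smul, one_smul, zero_smul]
    have h2 : (u * G.adjMatrix A) i l
        = ∑ k, ∑ j, (if G.Adj k l then (1 : ℂ) else 0) • (u i k * u j l) := by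
      simp_rw [← Finset.smul_sum, ← Finset.mul_sum, hu.col_sum, mul_one, Matrix.mul_apply,
        SimpleGraph.adjMatrix_apply, mul_ite, mul_one, mul_zero, ite_smul, one_smul, zero_smul]
    have hM := (h.comp fun p => if p then (1 : ℂ) else 0).smul_eq
    rw [h1, h2, Finset.sum_comm]
    exact Finset.sum_congr rfl fun k _ => Finset.sum_congr rfl fun j _ => hM i j k l
  · intro h i j k l hn
    -- Conversely, orthogonality in the column `l` and in the row `i` leaves one term on each side
    -- after multiplying by `u i k` and `u j l`.
    have h1 := congrArg (fun x => u i k * x * u j l) (congrFun (congrFun h i) l)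
    have e1 : u i k * (G.adjMatrix A * u) i l * u j l
        = (if G.Adj i j then 1 else 0) * (u i k * u j l) := by
      simp only [Matrix.mul_apply, SimpleGraph.adjMatrix_apply, ite_mul, one_mul, zero_mul,
        Finset.mul_sum, Finset.sum_mul, mul_ite, mul_zero]
      rw [Finset.sum_eq_single j]
      · split_ifs
        · rw [mul_assoc, hu.idem]
        · rfl
      · intro t _ ht
        split_ifs
        · rw [mul_assoc, hu.col_orth t j l ht, mul_zero]
        · rfl
      · simp
    have e2 : u i k * (u * G.adjMatrix A) i l * u j l
        = (if G.Adj k l then 1 else 0) * (u i k * u j l) := by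
      simp only [Matrix.mul_apply, SimpleGraph.adjMatrix_apply, ite_mul, one_mul, zero_mul,
        Finset.mul_sum, Finset.sum_mul, mul_ite, mul_zero, mul_one]
      rw [Finset.sum_eq_single k]
      · split_ifs
        · rw [hu.idem]
        · rfl
      · intro t _ ht
        split_ifs
        · rw [hu.row_orth i k t ht.symm, zero_mul]
        · rfl
      · simp
    simp only [e1, e2] at h1
    by_cases h3 : G.Adj i j <;> by_cases h4 : G.Adj k l <;> simp_all

end Preserves

theorem IsMagicUnitary.reindex {V W : Type} [Fintype V] [Fintype W] {A : Type*} [Ring A]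
    [StarRing A] {u : Matrix V V A} (hu : IsMagicUnitary u) (e : W ≃ V) :
    IsMagicUnitary (u.submatrix e e) where
  star_eq _ _ := hu.star_eq _ _
  idem _ _ := hu.idem _ _
  row_sum i := (e.sum_comp fun j => u (e i) j).trans (hu.row_sum _)
  col_sum j := (e.sum_comp fun i => u i (e j)).trans (hu.col_sum _)
  row_orth _ _ _ h := hu.row_orth _ _ _ fun h' => h (e.injective h')
  col_orth _ _ _ h := hu.col_orth _ _ _ fun h' => h (e.injective h')

theorem StarAlgHom.tensorMap_comp {A B C A' B' C' : Type*}
    [Ring A] [StarRing A] [Algebra ℂ A] [StarModule ℂ A]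
    [Ring B] [StarRing B] [Algebra ℂ B] [StarModule ℂ B]
    [Ring C] [StarRing C] [Algebra ℂ C] [StarModule ℂ C]
    [Ring A'] [StarRing A'] [Algebra ℂ A'] [StarModule ℂ A']
    [Ring B'] [StarRing B'] [Algebra ℂ B'] [StarModule ℂ B']
    [Ring C'] [StarRing C'] [Algebra ℂ C'] [StarModule ℂ C']
    (f : A →⋆ₐ[ℂ] B) (g : B →⋆ₐ[ℂ] C) (f' : A' →⋆ₐ[ℂ] B') (g' : B' →⋆ₐ[ℂ] C') (x : A ⊗[ℂ] A') :
    StarAlgHom.tensorMap g g' (StarAlgHom.tensorMap f f' x)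
      = StarAlgHom.tensorMap (g.comp f) (g'.comp f') x := by
  induction x using TensorProduct.induction_on with
  | zero => simp
  | tmul a b => simp
  | add x y hx hy => rw [map_add, map_add, map_add, hx, hy]

/-! ## Quantum automorphism groups of colourings -/

namespace QuantumPermutationGroup

theorem Isomorphic.trans {X Y Z : QuantumPermutationGroup} (h : X.Isomorphic Y)
    (h' : Y.Isomorphic Z) : X.Isomorphic Z := by
  obtain ⟨f, hf⟩ := h
  obtain ⟨g, hg⟩ := h'
  refine ⟨f.trans g, fun a => ?_⟩
  rw [StarAlgEquiv.trans_apply, hg, hf, StarAlgHom.tensorMap_comp]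
  rfl

/-- The matrix `w` exhibits `X` as the universal quantum group generated by a magic unitary
preserving the colouring `c`. -/
structure IsUniversal {V K : Type} [Fintype V] (X : QuantumPermutationGroup) (w : Matrix V V X.A)
    (c : V → V → K) : Prop where
  magic : IsMagicUnitary w
  preserves : Preserves w c
  comul_eq : ∀ i j, X.comul (w i j) = ∑ k, w i k ⊗ₜ[ℂ] w k j
  adjoin_eq_top : StarAlgebra.adjoin ℂ (Set.range fun p : V × V => w p.1 p.2) = ⊤
  exists_lift : ∀ {B : Type} [Ring B] [StarRing B] [Algebra ℂ B] [StarModule ℂ B]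
    (v : Matrix V V B), IsMagicUnitary v → Preserves v c →
      ∃ φ : X.A →⋆ₐ[ℂ] B, ∀ i j, φ (w i j) = v i j

/-- `X` is the quantum automorphism group of the colouring `c`. -/
def IsAutomorphismGroup {V K : Type} [Fintype V] (X : QuantumPermutationGroup)
    (c : V → V → K) : Prop :=
  ∃ w : Matrix V V X.A, X.IsUniversal w c

variable {V K : Type} [Fintype V] {c : V → V → K} {X Y : QuantumPermutationGroup}

theorem IsUniversal.hom_ext {w : Matrix V V X.A} (h : X.IsUniversal w c) {B : Type*} [Ring B]
    [StarRing B] [Algebra ℂ B] [StarModule ℂ B] {f g : X.A →⋆ₐ[ℂ] B}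
    (hfg : ∀ i j, f (w i j) = g (w i j)) : f = g :=
  StarAlgHom.ext_of_adjoin_eq_top h.adjoin_eq_top (by rintro _ ⟨p, rfl⟩; exact hfg _ _)

theorem IsAutomorphismGroup.isomorphic (hX : X.IsAutomorphismGroup c)
    (hY : Y.IsAutomorphismGroup c) : X.Isomorphic Y := by
  obtain ⟨w, hw⟩ := hX
  obtain ⟨v, hv⟩ := hY
  obtain ⟨f, hf⟩ := hw.exists_lift v hv.magic hv.preserves
  obtain ⟨g, hg⟩ := hv.exists_lift w hw.magic hw.preserves
  refine ⟨StarAlgEquiv.ofStarAlgHom f g (hw.hom_ext fun i j => by simp [hf, hg])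
    (hv.hom_ext fun i j => by simp [hf, hg]), fun a => ?_⟩
  have : Y.comul.comp f = (StarAlgHom.tensorMap f f).comp X.comul :=
    hw.hom_ext fun i j => by simp [hf, hv.comul_eq, hw.comul_eq]
  exact DFunLike.congr_fun this a

theorem IsAutomorphismGroup.of_isomorphic (hX : X.IsAutomorphismGroup c) (h : X.Isomorphic Y) :
    Y.IsAutomorphismGroup c := by
  obtain ⟨w, hw⟩ := hX
  obtain ⟨f, hf⟩ := h
  let f' : X.A →⋆ₐ[ℂ] Y.A := (f : X.A →⋆ₐ[ℂ] Y.A)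
  have hff : ∀ a, f' a = f a := fun _ => rfl
  refine ⟨w.map f', hw.magic.map f', hw.preserves.map f', fun i j => ?_, ?_, fun v hv hc => ?_⟩
  · rw [Matrix.map_apply, hff, hf, hw.comul_eq, map_sum]
    rfl
  · rw [eq_top_iff]
    intro y _
    have hle : StarAlgebra.adjoin ℂ (Set.range fun p : V × V => w p.1 p.2) ≤
        (StarAlgebra.adjoin ℂ (Set.range fun p : V × V => w.map f' p.1 p.2)).comap f' :=
      StarAlgebra.adjoin_le (by
        rintro _ ⟨p, rfl⟩; exact StarAlgebra.subset_adjoin ℂ _ ⟨p, rfl⟩)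
    rw [hw.adjoin_eq_top] at hle
    have : f (f.symm y) ∈ StarAlgebra.adjoin ℂ (Set.range fun p : V × V => w.map f' p.1 p.2) :=
      hle (x := f.symm y) (by simp)
    rwa [f.apply_symm_apply] at this
  · obtain ⟨φ, hφ⟩ := hw.exists_lift v hv hc
    refine ⟨φ.comp (f.symm : Y.A →⋆ₐ[ℂ] X.A), fun i j => ?_⟩
    rw [← hφ]
    exact congrArg φ (f.symm_apply_apply _)

/-- The universal property sees a colouring only through the magic unitaries that preserve it. Every
comparison of quantum groups below reduces to deriving two colourings from each other by the
operations on `Preserves`. -/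
theorem IsAutomorphismGroup.congr (hX : X.IsAutomorphismGroup c) {W L : Type} [Fintype W]
    {d : W → W → L} (e : V ≃ W)
    (h : ∀ {B : Type} [Ring B] [StarRing B] [Algebra ℂ B] [StarModule ℂ B] (v : Matrix V V B),
      IsMagicUnitary v → (Preserves v c ↔ Preserves v fun i j => d (e i) (e j))) :
    X.IsAutomorphismGroup d := by
  obtain ⟨w, hw⟩ := hX
  refine ⟨w.submatrix e.symm e.symm, hw.magic.reindex _, ?_, fun i j => ?_, ?_, fun v hv hd => ?_⟩
  · simpa using ((h w hw.magic).1 hw.preserves).submatrix e.symm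
  · rw [Matrix.submatrix_apply, hw.comul_eq]
    exact (e.symm.sum_comp fun k => w (e.symm i) k ⊗ₜ[ℂ] w k (e.symm j)).symm
  · rw [← hw.adjoin_eq_top]
    congr 1
    exact (e.symm.prodCongr e.symm).surjective.range_comp (fun p : V × V => w p.1 p.2)
  · obtain ⟨φ, hφ⟩ := hw.exists_lift (v.submatrix e e) (hv.reindex e)
      ((h _ (hv.reindex e)).2 (hd.submatrix e))
    exact ⟨φ, fun i j => by simp [hφ]⟩

theorem isAutomorphismGroup_ofGraph [Nonempty V] (G : SimpleGraph V) :
    (ofGraph G).IsAutomorphismGroup G.Adj := by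
  classical
  have hm : IsMagicUnitary (genMatrix (graphRelations G)) := (ofGraph G).magic
  refine ⟨genMatrix (graphRelations G), hm, ?_, (ofGraph G).comul_u, (ofGraph G).generates,
    fun v hv hG => ?_⟩
  · refine (Preserves.adj_iff hm G).2 ?_
    exact (graphRelations_iff G (PresentedStarAlgebra.mk _)).1
      fun P hP => PresentedStarAlgebra.mk_eq_zero (R := magicRelations V ∪ graphRelations G)
        (Or.inr hP)
  · have hv' : (varMatrix V).map (FreeStarAlgebra.lift fun p : V × V => v p.1 p.2) = v := by
      ext i j
      simp [varMatrix]
    refine ⟨PresentedStarAlgebra.lift (fun p => v p.1 p.2) ?_, fun i j =>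
      PresentedStarAlgebra.lift_gen _ _ (i, j)⟩
    rintro P (hP | hP)
    · exact (isMagicUnitary_iff (FreeStarAlgebra.lift _)).2 (by rwa [hv']) P hP
    · exact (graphRelations_iff G (FreeStarAlgebra.lift _)).2
        (by rw [hv']; convert (Preserves.adj_iff hv G).1 hG) P hP

/-- With at most one index all entries equal `1`. The empty index set is allowed on purpose: it is
the base of the induction on forests. -/
theorem isAutomorphismGroup_trivial [Subsingleton V] (c : V → V → K) :
    trivial.IsAutomorphismGroup c := by
  have h1 : ∀ {B : Type} [Ring B] [StarRing B] [Algebra ℂ B] [StarModule ℂ B]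
      (v : Matrix V V B), IsMagicUnitary v → ∀ i j, v i j = 1 := fun v hv i j => by
    rw [← hv.row_sum i, Fintype.sum_eq_single j fun k hk => (hk (Subsingleton.elim _ _)).elim]
  have hs : ∀ (i : V) (f : V → ℂ), ∑ j, f j = f i := fun i f =>
    Fintype.sum_eq_single i fun k hk => (hk (Subsingleton.elim _ _)).elim
  refine ⟨(fun _ _ => (1 : ℂ) : Matrix V V ℂ), ⟨?_, ?_, ?_, ?_, ?_, ?_⟩, ?_, ?_, ?_, ?_⟩
  · exact fun _ _ => star_one ℂ
  · exact fun _ _ => one_mul (1 : ℂ)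
  · exact fun i => hs i _
  · exact fun i => hs i _
  · exact fun i j k h => (h (Subsingleton.elim _ _)).elim
  · exact fun i j k h => (h (Subsingleton.elim _ _)).elim
  · intro i j k l h
    rw [Subsingleton.elim i k, Subsingleton.elim j l] at h
    exact (h rfl).elim
  · intro i j
    refine Eq.trans ?_ (Fintype.sum_eq_single j fun k hk => (hk (Subsingleton.elim _ _)).elim).symm
    exact map_one trivial.comul
  · exact eq_top_iff.2 fun c _ => algebraMap_mem (R := ℂ) (A := trivial.A) _ c
  · intro B _ _ _ _ v hv _
    exact ⟨(StarAlgHom.ofId ℂ B : ℂ →⋆ₐ[ℂ] B), fun i j => by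
      rw [h1 v hv]; exact map_one (StarAlgHom.ofId ℂ B)⟩

end QuantumPermutationGroup

theorem StarAlgHom.tensorMap_id {A B : Type*}
    [Ring A] [StarRing A] [Algebra ℂ A] [StarModule ℂ A]
    [Ring B] [StarRing B] [Algebra ℂ B] [StarModule ℂ B] (x : A ⊗[ℂ] B) :
    StarAlgHom.tensorMap (.id ℂ A) (.id ℂ B) x = x := by
  induction x using TensorProduct.induction_on with
  | zero => simp
  | tmul a b => simp
  | add x y hx hy => rw [map_add, hx, hy]

/-! ### Disjoint unions of colourings and free products -/

/-- The disjoint union of two colourings: all the colours of the two parts are distinguished. -/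
def sumColouring {V W K L : Type} (c : V → V → K) (d : W → W → L) :
    V ⊕ W → V ⊕ W → Option (K ⊕ L)
  | .inl i, .inl j => some (.inl (c i j))
  | .inr i, .inr j => some (.inr (d i j))
  | _, _ => none

theorem IsMagicUnitary.fromBlocks {V W : Type} [Fintype V] [Fintype W] {A : Type*} [Ring A]
    [StarRing A] {u : Matrix V V A} {v : Matrix W W A} (hX : IsMagicUnitary u)
    (hY : IsMagicUnitary v) : IsMagicUnitary (Matrix.fromBlocks u 0 0 v) := by
  refine ⟨?_, ?_, ?_, ?_, ?_, ?_⟩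
  · rintro (i | i) (j | j)
    · exact hX.star_eq i j
    · simp
    · simp
    · exact hY.star_eq i j
  · rintro (i | i) (j | j)
    · exact hX.idem i j
    · simp
    · simp
    · exact hY.idem i j
  · rintro (i | i)
    · simpa [Fintype.sum_sum_type] using hX.row_sum i
    · simpa [Fintype.sum_sum_type] using hY.row_sum i
  · rintro (i | i)
    · simpa [Fintype.sum_sum_type] using hX.col_sum i
    · simpa [Fintype.sum_sum_type] using hY.col_sum i
  · rintro (i | i) (j | j) (k | k) hn
    · exact hX.row_orth i j k fun h => hn (congrArg _ h)
    all_goals try simp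
    exact hY.row_orth i j k fun h => hn (congrArg _ h)
  · rintro (i | i) (k | k) (j | j) hn
    · exact hX.col_orth i k j fun h => hn (congrArg _ h)
    all_goals try simp
    exact hY.col_orth i k j fun h => hn (congrArg _ h)

namespace QuantumPermutationGroup

variable {V W K L : Type} [Fintype V] [Fintype W] {c : V → V → K} {d : W → W → L}
  {X Y : QuantumPermutationGroup}

theorem IsUniversal.hom_mem {w : Matrix V V X.A} (hw : X.IsUniversal w c) {B : Type*} [Ring B]
    [StarRing B] [Algebra ℂ B] [StarModule ℂ B] (f : X.A →⋆ₐ[ℂ] B) (S : StarSubalgebra ℂ B)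
    (h : ∀ i j, f (w i j) ∈ S) (a : X.A) : f a ∈ S := by
  have : StarAlgebra.adjoin ℂ (Set.range fun p : V × V => w p.1 p.2) ≤ S.comap f :=
    StarAlgebra.adjoin_le (by rintro _ ⟨p, rfl⟩; exact h p.1 p.2)
  rw [hw.adjoin_eq_top] at this
  exact this (show a ∈ (⊤ : StarSubalgebra ℂ X.A) from _root_.trivial)

/-- Diagonal pairs in the two parts have different colours, which makes a preserving magic unitary
block diagonal. As mixed pairs carry a single colour, nothing else relates the blocks, and this
freedom is the universal property of the free product. -/
theorem IsAutomorphismGroup.freeProduct (hX : X.IsAutomorphismGroup c)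
    (hY : Y.IsAutomorphismGroup d) :
    (freeProduct X Y).IsAutomorphismGroup (sumColouring c d) := by
  obtain ⟨w, hw⟩ := hX
  obtain ⟨z, hz⟩ := hY
  have hm := (hw.magic.map (freeInl X Y)).fromBlocks (hz.magic.map (freeInr X Y))
  have hwp := hw.preserves.map (freeInl X Y)
  have hzp := hz.preserves.map (freeInr X Y)
  refine ⟨Matrix.fromBlocks (w.map (freeInl X Y)) 0 0 (z.map (freeInr X Y)), hm, ?_, ?_, ?_,
    fun v hv hc => ?_⟩
  · change Preserves (A := FreeProductAlgebra X Y)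
      (Matrix.fromBlocks (w.map (freeInl X Y)) 0 0 (z.map (freeInr X Y))) _
    rintro (i | i) (j | j) (k | k) (l | l) hn <;>
      simp only [Matrix.fromBlocks_apply₁₁, Matrix.fromBlocks_apply₁₂, Matrix.fromBlocks_apply₂₁,
        Matrix.fromBlocks_apply₂₂, Matrix.zero_apply, mul_zero, zero_mul]
    · exact hwp _ _ _ _ fun e => hn (by simp [sumColouring, e])
    · exact (hn rfl).elim
    · exact (hn rfl).elim
    · exact hzp _ _ _ _ fun e => hn (by simp [sumColouring, e])
  · change ∀ i j, freeLift ((StarAlgHom.tensorMap (freeInl X Y) (freeInl X Y)).comp X.comul)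
      ((StarAlgHom.tensorMap (freeInr X Y) (freeInr X Y)).comp Y.comul)
      (Matrix.fromBlocks (w.map (freeInl X Y)) 0 0 (z.map (freeInr X Y)) i j) =
      ∑ k, Matrix.fromBlocks (w.map (freeInl X Y)) 0 0 (z.map (freeInr X Y)) i k ⊗ₜ[ℂ]
        Matrix.fromBlocks (w.map (freeInl X Y)) 0 0 (z.map (freeInr X Y)) k j
    rintro (i | i) (j | j) <;> simp [Fintype.sum_sum_type, hw.comul_eq, hz.comul_eq]
  · rw [eq_top_iff]
    refine PresentedStarAlgebra.adjoin_gen.ge.trans (StarAlgebra.adjoin_le ?_)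
    rintro _ ⟨a | b, rfl⟩
    · exact hw.hom_mem (freeInl X Y) _
        (fun i j => StarAlgebra.subset_adjoin ℂ _ (Set.mem_range_self (Sum.inl i, Sum.inl j))) a
    · exact hz.hom_mem (freeInr X Y) _
        (fun i j => StarAlgebra.subset_adjoin ℂ _ (Set.mem_range_self (Sum.inr i, Sum.inr j))) b
  · have h12 : ∀ i j, v (.inl i) (.inr j) = 0 := fun i j =>
      hc.eq_zero_of_ne hv (by simp [sumColouring])
    have h21 : ∀ i j, v (.inr i) (.inl j) = 0 := fun i j =>
      hc.eq_zero_of_ne hv (by simp [sumColouring])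
    have hv₁ : IsMagicUnitary v.toBlocks₁₁ := by
      refine ⟨fun _ _ => hv.star_eq _ _, fun _ _ => hv.idem _ _, fun i => ?_, fun i => ?_,
        fun _ _ _ h => hv.row_orth _ _ _ (by simpa using h),
        fun _ _ _ h => hv.col_orth _ _ _ (by simpa using h)⟩
      · simpa [Fintype.sum_sum_type, h12, Matrix.toBlocks₁₁] using hv.row_sum (.inl i)
      · simpa [Fintype.sum_sum_type, h21, Matrix.toBlocks₁₁] using hv.col_sum (.inl i)
    have hv₂ : IsMagicUnitary v.toBlocks₂₂ := by
      refine ⟨fun _ _ => hv.star_eq _ _, fun _ _ => hv.idem _ _, fun i => ?_, fun i => ?_,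
        fun _ _ _ h => hv.row_orth _ _ _ (by simpa using h),
        fun _ _ _ h => hv.col_orth _ _ _ (by simpa using h)⟩
      · simpa [Fintype.sum_sum_type, h21, Matrix.toBlocks₂₂] using hv.row_sum (.inr i)
      · simpa [Fintype.sum_sum_type, h12, Matrix.toBlocks₂₂] using hv.col_sum (.inr i)
    obtain ⟨φ, hφ⟩ := hw.exists_lift _ hv₁ fun i j k l h =>
      hc (.inl i) (.inl j) (.inl k) (.inl l) (by simpa [sumColouring] using h)
    obtain ⟨ψ, hψ⟩ := hz.exists_lift _ hv₂ fun i j k l h =>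
      hc (.inr i) (.inr j) (.inr k) (.inr l) (by simpa [sumColouring] using h)
    refine ⟨freeLift φ ψ, ?_⟩
    change ∀ i j, freeLift φ ψ
      (Matrix.fromBlocks (w.map (freeInl X Y)) 0 0 (z.map (freeInr X Y)) i j) = v i j
    rintro (i | i) (j | j) <;> simp [h12, h21, hφ, hψ] <;> rfl

/-- `ℂ` is the unit for unital free products. This is what allows rigid pieces, such as a root or a
rooted path, to be attached without changing the quantum group. -/
theorem freeProduct_trivial_isomorphic (X : QuantumPermutationGroup) :
    (QuantumPermutationGroup.freeProduct X trivial).Isomorphic X := by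
  let f : FreeProductAlgebra X trivial →⋆ₐ[ℂ] X.A :=
    freeLift (.id ℂ X.A) (StarAlgHom.ofId ℂ X.A : ℂ →⋆ₐ[ℂ] X.A)
  have hf : ∀ a, f (freeInl X trivial a) = a := fun a => freeLift_inl _ _ a
  have hext : ∀ {B : Type} [Ring B] [StarRing B] [Algebra ℂ B] [StarModule ℂ B]
      (g h : FreeProductAlgebra X trivial →⋆ₐ[ℂ] B),
      (∀ a, g (freeInl X trivial a) = h (freeInl X trivial a)) → g = h := fun g h hgh => by
    refine PresentedStarAlgebra.hom_ext fun x => ?_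
    rcases x with a | (b : ℂ)
    · exact hgh a
    · exact (AlgHomClass.commutes (g.comp (freeInr X trivial)) b).trans
        (AlgHomClass.commutes (h.comp (freeInr X trivial)) b).symm
  have h1 : (freeInl X trivial).comp f = .id ℂ _ :=
    hext _ _ fun a => congrArg (freeInl X trivial) (hf a)
  have h2 : f.comp (freeInl X trivial) = .id ℂ _ := StarAlgHom.ext hf
  refine ⟨StarAlgEquiv.ofStarAlgHom f (freeInl X trivial) h1 h2, fun a => ?_⟩
  have : X.comul.comp f = (StarAlgHom.tensorMap f f).comp
      (freeLift ((StarAlgHom.tensorMap (freeInl X trivial) (freeInl X trivial)).comp X.comul)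
        ((StarAlgHom.tensorMap (freeInr X trivial) (freeInr X trivial)).comp trivial.comul)) := by
    refine hext _ _ fun a => ?_
    rw [StarAlgHom.comp_apply, StarAlgHom.comp_apply, freeLift_inl, StarAlgHom.comp_apply,
      StarAlgHom.tensorMap_comp, h2, hf, StarAlgHom.tensorMap_id]
  exact DFunLike.congr_fun this a

/-! ### Copies of a colouring and wreath products -/

end QuantumPermutationGroup

/-- The disjoint union of copies, indexed by `N`, of a colouring. -/
noncomputable def copiesColouring (N : Type) {V K : Type} (c : V → V → K) :
    N × V → N × V → Option K := fun x y =>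
  open Classical in if x.1 = y.1 then some (c x.2 y.2) else none

theorem copiesColouring_self {N V K : Type} (c : V → V → K) (i : N) (k l : V) :
    copiesColouring N c (i, k) (i, l) = some (c k l) := if_pos rfl

theorem copiesColouring_ne {N V K : Type} (c : V → V → K) {i j : N} (h : i ≠ j) (k l : V) :
    copiesColouring N c (i, k) (j, l) = none := if_neg h

section copies

variable {N V K B : Type} [Fintype N] [Fintype V] {c : V → V → K}
  [Ring B] [StarRing B] [Algebra ℂ B] [StarModule ℂ B] {v : Matrix (N × V) (N × V) B}

theorem Preserves.copies_mul_eq_zero (hc : Preserves v (copiesColouring N c)) {i j j' : N}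
    (hj : j ≠ j') (k k' l l' : V) : v (i, k) (j, l) * v (i, k') (j', l') = 0 :=
  hc _ _ _ _ (by rw [copiesColouring_self, copiesColouring_ne c hj]; simp)

theorem Preserves.copies_mul_eq_zero' (hc : Preserves v (copiesColouring N c)) {i i' j : N}
    (hi : i ≠ i') (k k' l l' : V) : v (i, k) (j, l) * v (i', k') (j, l') = 0 :=
  hc _ _ _ _ (by rw [copiesColouring_self, copiesColouring_ne c hi]; simp)

/-- The block sums, which describe how the copies are permuted, computed along the row `k`. -/
def blockRow (v : Matrix (N × V) (N × V) B) (k : V) : Matrix N N B :=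
  fun i j => ∑ l, v (i, k) (j, l)

/-- Expand `1` as the sum of the block sums along the row `(i, k)`: two points of one copy cannot go
to different copies, so only the term `j` survives. The row `k` need not be the row `k'` of the
entry. -/
theorem blockRow_mul_apply (hv : IsMagicUnitary v) (hc : Preserves v (copiesColouring N c))
    (k k' l : V) (i j : N) : blockRow v k i j * v (i, k') (j, l) = v (i, k') (j, l) := by
  have h : ∑ j', blockRow v k i j' = 1 := by
    rw [← hv.row_sum (i, k), Fintype.sum_prod_type]; rfl
  conv_rhs => rw [← one_mul (v (i, k') (j, l)), ← h, Finset.sum_mul]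
  refine Eq.symm (Fintype.sum_eq_single j fun j' hj => ?_)
  rw [blockRow, Finset.sum_mul]
  exact Finset.sum_eq_zero fun l' _ => hc.copies_mul_eq_zero hj _ _ _ _

theorem apply_mul_blockRow (hv : IsMagicUnitary v) (hc : Preserves v (copiesColouring N c))
    (k k' l : V) (i j : N) : v (i, k') (j, l) * blockRow v k i j = v (i, k') (j, l) := by
  have h : ∑ j', blockRow v k i j' = 1 := by
    rw [← hv.row_sum (i, k), Fintype.sum_prod_type]; rfl
  conv_rhs => rw [← mul_one (v (i, k') (j, l)), ← h, Finset.mul_sum]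
  refine Eq.symm (Fintype.sum_eq_single j fun j' hj => ?_)
  rw [blockRow, Finset.mul_sum]
  exact Finset.sum_eq_zero fun l' _ => hc.copies_mul_eq_zero hj.symm _ _ _ _

theorem blockRow_apply_mul_ne (hc : Preserves v (copiesColouring N c))
    (k k' l : V) {i j j' : N} (hj : j ≠ j') : blockRow v k i j * v (i, k') (j', l) = 0 := by
  rw [blockRow, Finset.sum_mul]
  exact Finset.sum_eq_zero fun l' _ => hc.copies_mul_eq_zero hj _ _ _ _

/-- The product of the block row sum with the block column sum equals each of them. In particular
the block sum does not depend on the chosen row. -/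
theorem blockRow_eq_col_sum (hv : IsMagicUnitary v) (hc : Preserves v (copiesColouring N c))
    (k l : V) (i j : N) : blockRow v k i j = ∑ k', v (i, k') (j, l) := by
  have hcol : ∑ i', ∑ k', v (i', k') (j, l) = 1 := by
    rw [← hv.col_sum (j, l), Fintype.sum_prod_type]
  have h1 : blockRow v k i j * ∑ k', v (i, k') (j, l) = blockRow v k i j := by
    conv_rhs => rw [← mul_one (blockRow v k i j), ← hcol, Finset.mul_sum]
    refine Eq.symm (Fintype.sum_eq_single i fun i' hi => ?_)
    rw [blockRow, Finset.sum_mul_sum]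
    exact Finset.sum_eq_zero fun l' _ => Finset.sum_eq_zero fun k' _ =>
      hc.copies_mul_eq_zero' hi.symm _ _ _ _
  rw [← h1, Finset.mul_sum]
  exact Finset.sum_congr rfl fun k' _ => blockRow_mul_apply hv hc _ _ _ _ _

theorem isMagicUnitary_blockRow (hv : IsMagicUnitary v)
    (hc : Preserves v (copiesColouring N c)) (k : V) : IsMagicUnitary (blockRow v k) where
  star_eq i j := by simp only [blockRow, star_sum, hv.star_eq]
  idem i j := by
    conv_lhs => rw [blockRow.eq_def v k, Finset.mul_sum]
    exact Finset.sum_congr rfl fun l _ => blockRow_mul_apply hv hc k k l i j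
  row_sum i := by rw [← hv.row_sum (i, k), Fintype.sum_prod_type]; rfl
  col_sum j := by
    simp only [fun i => blockRow_eq_col_sum hv hc k k i j]
    rw [← hv.col_sum (j, k), Fintype.sum_prod_type]
  row_orth i j j' hj := by
    simp only [blockRow, Finset.sum_mul_sum]
    exact Finset.sum_eq_zero fun l' _ => Finset.sum_eq_zero fun k' _ =>
      hc.copies_mul_eq_zero hj _ _ _ _
  col_orth i i' j hi := by
    simp only [blockRow, Finset.sum_mul_sum]
    exact Finset.sum_eq_zero fun l' _ => Finset.sum_eq_zero fun k' _ =>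
      hc.copies_mul_eq_zero' hi _ _ _ _

/-- The sums which describe the permutation of the points of the `i`-th copy. -/
def fibreSum (v : Matrix (N × V) (N × V) B) (i : N) : Matrix V V B :=
  fun k l => ∑ j, v (i, k) (j, l)

theorem fibreSum_mul (hc : Preserves v (copiesColouring N c)) (i : N) (k k' l l' : V) :
    fibreSum v i k l * fibreSum v i k' l' = ∑ j, v (i, k) (j, l) * v (i, k') (j, l') := by
  rw [fibreSum, fibreSum, Finset.sum_mul_sum]
  exact Finset.sum_congr rfl fun j _ => Fintype.sum_eq_single j fun j' hj =>
    hc.copies_mul_eq_zero hj.symm _ _ _ _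

theorem isMagicUnitary_fibreSum (hv : IsMagicUnitary v)
    (hc : Preserves v (copiesColouring N c)) (i : N) : IsMagicUnitary (fibreSum v i) where
  star_eq k l := by simp only [fibreSum, star_sum, hv.star_eq]
  idem k l := by
    rw [fibreSum_mul hc]
    exact Finset.sum_congr rfl fun j _ => hv.idem _ _
  row_sum k := by
    simp only [fibreSum]
    rw [Finset.sum_comm, ← hv.row_sum (i, k), Fintype.sum_prod_type]
  col_sum l := by
    simp only [fibreSum]
    rw [Finset.sum_comm, ← (isMagicUnitary_blockRow hv hc l).row_sum i]
    exact Finset.sum_congr rfl fun j _ => (blockRow_eq_col_sum hv hc _ _ _ _).symm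
  row_orth k l l' hl := by
    rw [fibreSum_mul hc]
    exact Finset.sum_eq_zero fun j _ => hv.row_orth _ _ _ (by simpa using hl)
  col_orth k k' l hk := by
    rw [fibreSum_mul hc]
    exact Finset.sum_eq_zero fun j _ => hv.col_orth _ _ _ (by simpa using hk)

theorem preserves_fibreSum (hc : Preserves v (copiesColouring N c)) (i : N) :
    Preserves (fibreSum v i) c := fun k k' l l' hn => by
  rw [fibreSum_mul hc]
  exact Finset.sum_eq_zero fun j _ => hc _ _ _ _ (by simpa [copiesColouring_self] using hn)

/-- This factorisation, together with its reverse `blockRow_mul_fibreSum`, contains the commutation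
relation that defines the wreath product. -/
theorem fibreSum_mul_blockRow (hv : IsMagicUnitary v)
    (hc : Preserves v (copiesColouring N c)) (i j : N) (k k' l : V) :
    fibreSum v i k l * blockRow v k' i j = v (i, k) (j, l) := by
  rw [fibreSum, Finset.sum_mul, Fintype.sum_eq_single j]
  · exact apply_mul_blockRow hv hc _ _ _ _ _
  · intro j' hj
    rw [blockRow, Finset.mul_sum]
    exact Finset.sum_eq_zero fun l' _ => hc.copies_mul_eq_zero hj _ _ _ _

theorem blockRow_mul_fibreSum (hv : IsMagicUnitary v)
    (hc : Preserves v (copiesColouring N c)) (i j : N) (k k' l : V) :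
    blockRow v k' i j * fibreSum v i k l = v (i, k) (j, l) := by
  rw [fibreSum, Finset.mul_sum, Fintype.sum_eq_single j]
  · exact blockRow_mul_apply hv hc _ _ _ _ _
  · intro j' hj
    exact blockRow_apply_mul_ne hc _ _ _ hj.symm

end copies

namespace QuantumPermutationGroup

variable {V K : Type} [Fintype V] {c : V → V → K} {X : QuantumPermutationGroup}

theorem symm_exists_lift {n : ℕ} [NeZero n] {B : Type} [Ring B] [StarRing B] [Algebra ℂ B]
    [StarModule ℂ B] {p : Matrix (Fin n) (Fin n) B} (hp : IsMagicUnitary p) :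
    ∃ φ : (symm n).A →⋆ₐ[ℂ] B, ∀ i j, φ (symmU n i j) = p i j := by
  have hp' : (varMatrix (Fin n)).map
      (FreeStarAlgebra.lift fun q : Fin n × Fin n => p q.1 q.2) = p := by
    ext i j
    simp [varMatrix]
  refine ⟨PresentedStarAlgebra.lift (fun q => p q.1 q.2) ?_, fun i j =>
    PresentedStarAlgebra.lift_gen _ _ (i, j)⟩
  rintro P (hP | hP)
  · exact (isMagicUnitary_iff (FreeStarAlgebra.lift _)).2 (by rwa [hp']) P hP
  · exact hP.elim

/-- A magic unitary preserving the copies splits into a block permutation and, for each copy, a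
magic unitary preserving `c`; the universal property of the wreath product reassembles them. A point
of `V` is needed to read the block permutation off a row. -/
theorem IsAutomorphismGroup.wreath [Nonempty V] (hX : X.IsAutomorphismGroup c) (n : ℕ) [NeZero n] :
    (wreath X n).IsAutomorphismGroup (copiesColouring (Fin n) c) := by
  obtain ⟨w, hw⟩ := hX
  have hP := wreathP_magic X n
  have hc := wreath_comm X n
  let z : Matrix (Fin n × V) (Fin n × V) (WreathAlgebra X n) :=
    fun r s => wreathNu X n r.1 (w r.2 s.2) * wreathP X n r.1 s.1
  have hz : ∀ i k j l, z (i, k) (j, l) = wreathNu X n i (w k l) * wreathP X n i j :=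
    fun _ _ _ _ => rfl
  refine ⟨z, ⟨?_, ?_, ?_, ?_, ?_, ?_⟩, ?_, ?_, ?_, fun v hv hp => ?_⟩
  · rintro ⟨i, k⟩ ⟨j, l⟩
    change star (z (i, k) (j, l)) = z (i, k) (j, l)
    rw [hz, star_mul, hP.star_eq, ← map_star, hw.magic.star_eq, (hc i j _).eq]
  · rintro ⟨i, k⟩ ⟨j, l⟩
    change z (i, k) (j, l) * z (i, k) (j, l) = z (i, k) (j, l)
    rw [hz, (hc i j _).symm.mul_mul_mul_comm, hP.idem, ← map_mul, hw.magic.idem]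
  · rintro ⟨i, k⟩
    change ∑ s, z (i, k) s = 1
    rw [Fintype.sum_prod_type]
    simp only [hz, ← Finset.sum_mul, ← map_sum, hw.magic.row_sum, map_one, one_mul, hP.row_sum]
  · rintro ⟨j, l⟩
    change ∑ s, z s (j, l) = 1
    rw [Fintype.sum_prod_type]
    simp only [hz, ← Finset.sum_mul, ← map_sum, hw.magic.col_sum, map_one, one_mul, hP.col_sum]
  · rintro ⟨i, k⟩ ⟨j, l⟩ ⟨j', l'⟩ hn
    change z (i, k) (j, l) * z (i, k) (j', l') = 0
    rw [hz, hz, (hc i j _).symm.mul_mul_mul_comm]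
    by_cases hj : j = j'
    · rw [← map_mul, hw.magic.row_orth k l l' fun hl => hn (by rw [hj, hl]), map_zero, zero_mul]
    · rw [hP.row_orth i j j' hj, mul_zero]
  · rintro ⟨i, k⟩ ⟨i', k'⟩ ⟨j, l⟩ hn
    change z (i, k) (j, l) * z (i', k') (j, l) = 0
    rw [hz, hz]
    by_cases hi : i = i'
    · subst hi
      rw [(hc i j _).symm.mul_mul_mul_comm, ← map_mul,
        hw.magic.col_orth k k' l fun hk => hn (by rw [hk]), map_zero, zero_mul]
    · rw [(hc i' j _).eq, mul_assoc, ← mul_assoc (wreathP X n i j), hP.col_orth i i' j hi,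
        zero_mul, mul_zero]
  · rintro ⟨i, k⟩ ⟨i', k'⟩ ⟨j, l⟩ ⟨j', l'⟩ hn
    change z (i, k) (j, l) * z (i', k') (j', l') = 0
    rw [hz, hz]
    by_cases hi : i = i'
    · subst hi
      rw [(hc i j _).symm.mul_mul_mul_comm]
      by_cases hj : j = j'
      · subst hj
        rw [copiesColouring_self, copiesColouring_self] at hn
        rw [← map_mul, hw.preserves k k' l l' fun e => hn (by rw [e]), map_zero, zero_mul]
      · rw [hP.row_orth i j j' hj, mul_zero]
    · by_cases hj : j = j'
      · subst hj
        rw [(hc i' j _).eq, mul_assoc, ← mul_assoc (wreathP X n i j), hP.col_orth i i' j hi,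
          zero_mul, mul_zero]
      · exact (hn (by rw [copiesColouring_ne c hi, copiesColouring_ne c hj])).elim
  · rintro ⟨i, k⟩ ⟨j, l⟩
    change wreathLift (wreathComulNu X n) (wreathComulSymm X n) (wreathComul_comm X n)
      (wreathNu X n i (w k l) * wreathP X n i j) = ∑ s, z (i, k) s ⊗ₜ[ℂ] z s (j, l)
    rw [map_mul, wreathLift_nu, wreathP, wreathLift_symm, wreathComul_mul,
      Fintype.sum_prod_type]
    refine Finset.sum_congr rfl fun t _ => ?_
    rw [hw.comul_eq, map_sum, Finset.sum_mul]
    exact Finset.sum_congr rfl fun r _ => Algebra.TensorProduct.tmul_mul_tmul _ _ _ _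
  · rw [eq_top_iff]
    refine PresentedStarAlgebra.adjoin_gen.ge.trans (StarAlgebra.adjoin_le ?_)
    have hmem : ∀ i k j l, z (i, k) (j, l) ∈ StarAlgebra.adjoin ℂ (Set.range fun
        p : (Fin n × V) × (Fin n × V) => z p.1 p.2) :=
      fun i k j l => StarAlgebra.subset_adjoin ℂ _ (Set.mem_range_self ((i, k), (j, l)))
    rintro _ ⟨⟨i, a⟩ | b, rfl⟩
    · refine hw.hom_mem (wreathNu X n i) _ (fun k l => ?_) a
      have := sum_mem (t := Finset.univ) fun j _ => hmem i k j l
      have e : ∑ j, z (i, k) (j, l) = wreathNu X n i (w k l) := by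
        simp only [hz]
        rw [← Finset.mul_sum, hP.row_sum, mul_one]
      exact e ▸ this
    · refine hom_mem (symm n) (wreathSymm X n) _ (fun (i j : Fin n) => ?_) b
      change wreathP X n i j ∈ _
      obtain ⟨k⟩ := ‹Nonempty V›
      have := sum_mem (t := Finset.univ) fun l _ => hmem i k j l
      have e : ∑ l, z (i, k) (j, l) = wreathP X n i j := by
        simp only [hz]
        rw [← Finset.sum_mul, ← map_sum, hw.magic.row_sum, map_one, one_mul]
      exact e ▸ this
  · obtain ⟨k₀⟩ := ‹Nonempty V›
    choose f hf using fun i => hw.exists_lift _ (isMagicUnitary_fibreSum hv hp i)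
      (preserves_fibreSum hp i)
    obtain ⟨g, hg⟩ := symm_exists_lift (isMagicUnitary_blockRow hv hp k₀)
    have hcomm : ∀ i j a, Commute (f i a) (g (symmU n i j)) := fun i j a => by
      rw [hg]
      have hstar : star (blockRow v k₀ i j) = blockRow v k₀ i j :=
        (isMagicUnitary_blockRow hv hp k₀).star_eq i j
      -- Commutation holds on the generators by the two factorisations of `v`, and a centralizer is
      -- a *-subalgebra.
      have := hw.hom_mem (f i) (StarSubalgebra.centralizer ℂ {blockRow v k₀ i j})
        (fun k l => by
          rw [hf, StarSubalgebra.mem_centralizer_iff]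
          rintro _ rfl
          rw [hstar, blockRow_mul_fibreSum hv hp, fibreSum_mul_blockRow hv hp]
          exact ⟨rfl, rfl⟩) a
      exact (StarSubalgebra.mem_centralizer_iff ℂ |>.1 this _ rfl).1.symm
    refine ⟨wreathLift f g hcomm, ?_⟩
    rintro ⟨i, k⟩ ⟨j, l⟩
    change wreathLift f g hcomm (wreathNu X n i (w k l) * wreathP X n i j) = _
    rw [map_mul, wreathLift_nu, wreathP, wreathLift_symm, hf, hg, fibreSum_mul_blockRow hv hp]

end QuantumPermutationGroup

/-! ## Rooted forests -/

open Relation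

/-- A relation `P` is a rooted forest, with `P x y` meaning that `y` is the parent of `x`, if each
vertex has at most one parent and some rank function decreases from a vertex to its parent. -/
structure IsForest {V : Type} (P : V → V → Prop) : Prop where
  unique : ∀ x y z, P x y → P x z → y = z
  exists_rank : ∃ rank : V → ℕ, ∀ x y, P x y → rank y < rank x

/-- A root of a forest is a vertex without a parent. -/
def IsRoot {V : Type} (P : V → V → Prop) (x : V) : Prop := ∀ y, ¬ P x y

/-- Two vertices of a forest have the same shape if the trees of their descendants are
isomorphic. -/
inductive SameShape {V : Type} (P : V → V → Prop) : V → V → Prop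
  | mk {i j : V} (σ : {c // P c i} ≃ {c // P c j}) (h : ∀ c, SameShape P c.1 (σ c).1) :
    SameShape P i j

namespace IsForest

variable {V : Type} {P : V → V → Prop}

theorem exists_isRoot (hP : IsForest P) (x : V) : ∃ r, IsRoot P r ∧ ReflTransGen P x r := by
  obtain ⟨rank, hr⟩ := hP.exists_rank
  induction hn : rank x using Nat.strong_induction_on generalizing x with
  | _ n ih =>
    by_cases h : IsRoot P x
    · exact ⟨x, h, .refl⟩
    · simp only [IsRoot, not_forall, not_not] at h
      obtain ⟨y, hy⟩ := h
      obtain ⟨r, h1, h2⟩ := ih (rank y) (hn ▸ hr _ _ hy) y rfl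
      exact ⟨r, h1, h2.head hy⟩

theorem eq_of_isRoot {r s : V} (hr : IsRoot P r) (h : ReflTransGen P r s) : r = s := by
  rcases h.cases_head with h | ⟨y, hy, _⟩
  · exact h
  · exact (hr y hy).elim

theorem total (hP : IsForest P) {x y z : V} (hy : ReflTransGen P x y) (hz : ReflTransGen P x z) :
    ReflTransGen P y z ∨ ReflTransGen P z y :=
  ReflTransGen.total_of_right_unique (fun a b c => hP.unique a b c) hy hz

theorem isRoot_unique (hP : IsForest P) {x r s : V} (hr : IsRoot P r) (hs : IsRoot P s)
    (hxr : ReflTransGen P x r) (hxs : ReflTransGen P x s) : r = s := by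
  rcases hP.total hxr hxs with h | h
  · exact eq_of_isRoot hr h
  · exact (eq_of_isRoot hs h).symm

theorem not_reflTransGen (hP : IsForest P) {x y : V} (h : P x y) : ¬ ReflTransGen P y x := by
  obtain ⟨rank, hr⟩ := hP.exists_rank
  intro h'
  have : rank x ≤ rank y := by
    clear h
    induction h' with
    | refl => rfl
    | tail _ h ih => exact (hr _ _ h).le.trans ih
  exact absurd (hr _ _ h) (by omega)

/-- Two children of `i` above the same vertex are comparable; if they were distinct, one would lie
above the other through `i` and create a cycle. -/
theorem child_unique (hP : IsForest P) {v c c' i : V} (hc : P c i) (hc' : P c' i)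
    (h : ReflTransGen P v c) (h' : ReflTransGen P v c') : c = c' := by
  have key : ∀ {a b}, P a i → P b i → ReflTransGen P a b → a = b := fun {a b} ha hb hab => by
    rcases hab.cases_head with e | ⟨y, hy, hyb⟩
    · exact e
    · rw [hP.unique _ _ _ hy ha] at hyb
      exact (hP.not_reflTransGen hb hyb).elim
  rcases hP.total h h' with h | h
  · exact key hc hc' h
  · exact (key hc' hc h).symm

/-- Induction along `P` passes from children to their parent, hence against the rank; finiteness
bounds the rank so that it can be reversed. -/
theorem wellFounded [Finite V] (hP : IsForest P) : WellFounded P := by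
  obtain ⟨rank, hr⟩ := hP.exists_rank
  obtain ⟨M, hM⟩ := (Set.finite_range rank).bddAbove
  refine Subrelation.wf (r := InvImage (· < ·) fun v => M - rank v) ?_ (InvImage.wf _ wellFounded_lt)
  intro x y h
  have h1 := hr _ _ h
  have h2 : rank x ≤ M := hM ⟨x, rfl⟩
  change M - rank x < M - rank y
  omega

theorem comap {W : Type} (hP : IsForest P) {f : W → V} (hf : Function.Injective f) :
    IsForest fun x y => P (f x) (f y) where
  unique _ _ _ h h' := hf (hP.unique _ _ _ h h')
  exists_rank := by
    obtain ⟨rank, hr⟩ := hP.exists_rank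
    exact ⟨rank ∘ f, fun _ _ h => hr _ _ h⟩

end IsForest

/-! ### Shapes of rooted trees -/

namespace SameShape

variable {V : Type} {P : V → V → Prop}

theorem refl (hP : WellFounded P) (i : V) : SameShape P i i := by
  induction i using hP.induction with
  | _ i ih => exact ⟨.refl _, fun c => ih c c.2⟩

theorem symm {i j : V} (h : SameShape P i j) : SameShape P j i := by
  induction h with
  | mk σ _ ih => exact ⟨σ.symm, fun c => by simpa using ih (σ.symm c)⟩

theorem trans {i j k : V} (h : SameShape P i j) (h' : SameShape P j k) : SameShape P i k := by
  induction h generalizing k with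
  | mk σ _ ih =>
    obtain ⟨τ, hτ⟩ := h'
    exact ⟨σ.trans τ, fun c => ih c (hτ _)⟩

/-- Having the same shape, as an equivalence relation. -/
def setoid (hP : WellFounded P) : Setoid V := ⟨SameShape P, refl hP, symm, trans⟩

-- Matching the children class by class, as the counts permit, gives the bijection demanded by
-- `SameShape`.
open Classical in
theorem of_card_eq [Fintype V] (hP : WellFounded P) {i j : V}
    (h : ∀ a : Quotient (setoid hP),
      (Finset.univ.filter fun c => P c i ∧ (Quotient.mk _ c) = a).card
        = (Finset.univ.filter fun c => P c j ∧ (Quotient.mk _ c) = a).card) : SameShape P i j := by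
  have e : ∀ a : Quotient (setoid hP), Nonempty
      ({c : {c // P c i} // Quotient.mk (setoid hP) c.1 = a} ≃
        {c : {c // P c j} // Quotient.mk (setoid hP) c.1 = a}) := fun a => by
    refine Fintype.card_eq.1 ?_
    rw [Fintype.card_congr (Equiv.subtypeSubtypeEquivSubtypeInter _ fun c => Quotient.mk _ c = a),
      Fintype.card_congr (Equiv.subtypeSubtypeEquivSubtypeInter _ fun c => Quotient.mk _ c = a),
      Fintype.card_subtype, Fintype.card_subtype, h a]
  exact ⟨Equiv.ofFiberEquiv fun a => (e a).some, fun c =>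
    Quotient.exact (s := setoid hP) (Equiv.ofFiberEquiv_map (fun a => (e a).some) c).symm⟩

/-- By induction from the children. Suppose `u i j` is nonzero and let `C k` be the set of children
of `k` in a given shape class. Summing `u c d * u i j` over `C i × C j` in the two orders gives `(C
i).card • u i j` and `(C j).card • u i j`, so `i` and `j` have equally many children of each shape.
-/
theorem eq_zero_of_not [Fintype V] (hP : WellFounded P) {A : Type*} [Ring A] [StarRing A]
    [Algebra ℂ A] [StarModule ℂ A] {u : Matrix V V A} (hu : IsMagicUnitary u) (h : Preserves u P)
    (i j : V) (hij : ¬ SameShape P i j) : u i j = 0 := by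
  classical
  induction i using hP.induction generalizing j with
  | _ i ih =>
  by_contra h0
  refine hij (of_card_eq hP fun a => ?_)
  set C := fun k => Finset.univ.filter fun c => P c k ∧ (Quotient.mk (setoid hP) c) = a with hC
  have hz : ∀ c d, P c i → (Quotient.mk (setoid hP) c) ≠ (Quotient.mk (setoid hP) d) →
      u c d = 0 := fun c d hc hcd => ih c hc d fun e => hcd (Quotient.sound e)
  have h1 : ∑ c ∈ C i, ∑ d ∈ C j, u c d * u i j = (C i).card • u i j := by
    rw [← Finset.sum_const]
    refine Finset.sum_congr rfl fun c hc => ?_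
    -- Row `c` sums to `1`, and after multiplication by `u i j` only columns in `C j` contribute:
    -- children of `j` of another class are excluded by induction, other vertices by preservation of
    -- `P`.
    obtain ⟨hc, hca⟩ : P c i ∧ Quotient.mk (setoid hP) c = a := by simpa [hC] using hc
    have : ∑ d, u c d * u i j = u i j := by rw [← Finset.sum_mul, hu.row_sum, one_mul]
    refine Eq.trans (Finset.sum_subset (Finset.subset_univ _) fun d _ hd => ?_) this
    by_cases hdj : P d j
    · rw [hz c d hc fun e => hd (by simp [hC, hdj, ← e, hca]), zero_mul]
    · exact h c i d j fun e => hdj (e ▸ hc)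
  have h2 : ∑ d ∈ C j, ∑ c ∈ C i, u c d * u i j = (C j).card • u i j := by
    rw [← Finset.sum_const]
    refine Finset.sum_congr rfl fun d hd => ?_
    obtain ⟨hd, hda⟩ : P d j ∧ Quotient.mk (setoid hP) d = a := by simpa [hC] using hd
    have : ∑ c, u c d * u i j = u i j := by rw [← Finset.sum_mul, hu.col_sum, one_mul]
    refine Eq.trans (Finset.sum_subset (Finset.subset_univ _) fun c _ hc => ?_) this
    by_cases hci : P c i
    · rw [hz c d hci fun e => hc (by simp [hC, hci, e, hda]), zero_mul]
    · exact h c i d j fun e => hci (e ▸ hd)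
  rw [Finset.sum_comm] at h2
  have h3 := h1.symm.trans h2
  rw [← Nat.cast_smul_eq_nsmul ℂ, ← Nat.cast_smul_eq_nsmul ℂ] at h3
  exact_mod_cast smul_left_injective ℂ h0 h3

/-- The maps obtained for the children of `i` are glued together; each proper descendant of `i` lies
below exactly one child. -/
theorem exists_map (hP : IsForest P) {i j : V} (h : SameShape P i j) :
    ∃ f : V → V, f i = j ∧
      ∀ v, ReflTransGen P v i → Set.BijOn f {c | P c v} {c | P c (f v)} := by
  classical
  induction h with
  | @mk i j σ _ ih =>
  choose f hf hfb using ih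
  -- The last value `v` is a default, taken only outside the descendants of `i`, where nothing is
  -- claimed.
  let F : V → V := fun v => if v = i then j else
    if h : ∃ c : {c // P c i}, ReflTransGen P v c then f h.choose v else v
  have hF : ∀ (c : {c // P c i}) v, ReflTransGen P v c → F v = f c v := fun c v hv => by
    have h1 : v ≠ i := by rintro rfl; exact hP.not_reflTransGen c.2 hv
    have h2 : ∃ c : {c // P c i}, ReflTransGen P v c := ⟨c, hv⟩
    have h3 : h2.choose = c :=
      Subtype.ext (hP.child_unique h2.choose.2 c.2 h2.choose_spec hv)
    simp only [F, if_neg h1, dif_pos h2, h3]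
  have hFi : F i = j := if_pos rfl
  refine ⟨F, hFi, fun v hv => ?_⟩
  rcases hv.cases_tail with rfl | ⟨c, hvc, hc⟩
  · rw [hFi]
    have h1 : ∀ c : {c // P c i}, F c = σ c := fun c => (hF c c .refl).trans (hf c)
    refine ⟨fun c hc => ?_, fun c hc d hd hcd => ?_, fun d hd => ?_⟩
    · rw [h1 ⟨c, hc⟩]; exact (σ ⟨c, hc⟩).2
    · rw [h1 ⟨c, hc⟩, h1 ⟨d, hd⟩] at hcd
      exact congrArg Subtype.val (σ.injective (Subtype.ext hcd))
    · exact ⟨(σ.symm ⟨d, hd⟩).1, (σ.symm ⟨d, hd⟩).2, by rw [h1]; simp⟩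
  · rw [hF ⟨c, hc⟩ v hvc]
    exact (hfb ⟨c, hc⟩ v hvc).congr fun d hd => (hF ⟨c, hc⟩ d (hvc.head hd)).symm

end SameShape

/-! ### Colourings of unions of forests -/

namespace Preserves

variable {V W : Type} [Fintype V] [Fintype W] {A : Type*} [Ring A] [StarRing A] [Algebra ℂ A]
  [StarModule ℂ A] {u : Matrix V V A} {P : V → V → Prop}

/-- Properties of single vertices are encoded as colourings that ignore the second index.
Composition with the full relation produces this one. -/
theorem parent (hu : IsMagicUnitary u) (h : Preserves u P) :
    Preserves u fun i (_ : V) => ∃ k, P i k := by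
  simpa using h.relComp hu (const True)

theorem isRoot (hu : IsMagicUnitary u) (h : Preserves u P) :
    Preserves u fun i (_ : V) => IsRoot P i := by
  simpa [IsRoot] using (h.parent hu).not

theorem left_of_sumColouring {K L : Type} {c : V → V → K} {d : W → W → L}
    {v : Matrix (V ⊕ W) (V ⊕ W) A} (hv : IsMagicUnitary v) (h : Preserves v (sumColouring c d)) :
    Preserves v fun i (_ : V ⊕ W) => i.isLeft := by
  refine of_eq_zero fun i k hn => h.eq_zero_of_ne hv ?_
  rcases i with i | i <;> rcases k with k | k <;> simp_all [sumColouring]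

theorem sumColouring_of_left {K L M : Type} {c : V → V → K} {d : W → W → L}
    {R : V ⊕ W → V ⊕ W → M} {v : Matrix (V ⊕ W) (V ⊕ W) A} (hv : IsMagicUnitary v)
    (h : Preserves v fun i (_ : V ⊕ W) => i.isLeft) (hR : Preserves v R)
    (hc : ∀ i j k l, R (.inl i) (.inl j) = R (.inl k) (.inl l) → c i j = c k l)
    (hd : ∀ i j k l, R (.inr i) (.inr j) = R (.inr k) (.inr l) → d i j = d k l) :
    Preserves v (sumColouring c d) := by
  refine (h.prodMk (h.swap hv)).of_eq hR fun i j k l h1 h2 => ?_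
  rcases i with i | i <;> rcases j with j | j <;> rcases k with k | k <;> rcases l with l | l <;>
    simp_all [sumColouring]
  · exact hc _ _ _ _ h2
  · exact hd _ _ _ _ h2

/-- The relation which holds within the copies of `V`. -/
def copiesRel (N : Type) (P : V → V → Prop) (x y : N × V) : Prop := x.1 = y.1 ∧ P x.2 y.2

/-- The colouring also records which vertices share a copy. Since each copy has a vertex above all
the others, this means having a common ancestor, which is definable from the forest relation alone.
-/
theorem copiesRel_iff {N : Type} [Fintype N] {v : Matrix (N × V) (N × V) A}
    (hv : IsMagicUnitary v) {r : V} (hr : ∀ x, ReflTransGen P x r) :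
    Preserves v (copiesColouring N P) ↔ Preserves v (copiesRel N P) := by
  constructor
  · intro h
    have := h.comp fun o => o.elim False id
    convert this using 3 with x y
    rcases x with ⟨a, x⟩
    rcases y with ⟨b, y⟩
    by_cases hab : a = b
    · subst hab; simp [copiesRel, copiesColouring_self]
    · simp [copiesRel, copiesColouring_ne _ hab, hab]
  · intro h
    have hT := h.reflTransGen hv
    have hsame : Preserves v fun x y => x.1 = y.1 := by
      -- Composing the ancestor relation with its transpose expresses the existence of a common
      -- ancestor.
      have := hT.relComp hv (hT.swap hv)
      convert this using 3 with x y
      have hfst : ∀ {x y : N × V}, ReflTransGen (copiesRel N P) x y → x.1 = y.1 := fun h => by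
        induction h with
        | refl => rfl
        | tail _ h ih => exact ih.trans h.1
      have hlift : ∀ (a : N) {x y : V}, ReflTransGen P x y →
          ReflTransGen (copiesRel N P) (a, x) (a, y) := fun a {x y} h =>
        h.lift (fun x => (a, x)) fun x y h => ⟨rfl, h⟩
      refine ⟨fun h => ?_, fun ⟨k, hx, hy⟩ => (hfst hx).trans (hfst hy).symm⟩
      rcases x with ⟨a, x⟩
      rcases y with ⟨b, y⟩
      obtain rfl : a = b := h
      exact ⟨(a, r), hlift a (hr x), hlift a (hr y)⟩
    refine hsame.of_eq h fun x y z w h1 h2 => ?_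
    rcases x with ⟨a, x⟩
    rcases y with ⟨b, y⟩
    rcases z with ⟨a', z⟩
    rcases w with ⟨b', w⟩
    by_cases hab : a = b
    · have hab' : a' = b' := by simpa [hab] using h1
      subst hab hab'
      simpa [copiesRel, copiesColouring_self] using h2
    · have hab' : a' ≠ b' := by simpa [hab] using h1
      rw [copiesColouring_ne _ hab, copiesColouring_ne _ hab']

end Preserves

open Preserves (copiesRel copiesRel_iff)

/-- The forest obtained by joining the roots of a forest to a new root. -/
def addRoot {V : Type} (P : V → V → Prop) : Option V → Option V → Prop
  | some i, some j => P i j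
  | some i, none => IsRoot P i
  | none, _ => False

/-- The disjoint union of two forests. -/
def sumRel {V W : Type} (P : V → V → Prop) (Q : W → W → Prop) : V ⊕ W → V ⊕ W → Prop
  | .inl i, .inl j => P i j
  | .inr i, .inr j => Q i j
  | _, _ => False

namespace QuantumPermutationGroup

variable {V W : Type} [Fintype V] [Fintype W] {X Y : QuantumPermutationGroup} {P : V → V → Prop}
  {Q : W → W → Prop}

theorem IsAutomorphismGroup.of_equiv {K : Type} {c : V → V → K} {d : W → W → K}
    (hX : X.IsAutomorphismGroup c) (e : V ≃ W) (h : ∀ i j, c i j = d (e i) (e j)) :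
    X.IsAutomorphismGroup d :=
  hX.congr e fun v _ => by rw [funext fun i => funext fun j => h i j]

/-- The new root is the only vertex without a parent, so it is distinguished, and the relation is
interdefinable with the disjoint union of `P` and a point. The point contributes a trivial free
factor. -/
theorem IsAutomorphismGroup.addRoot (hX : X.IsAutomorphismGroup P) :
    X.IsAutomorphismGroup (addRoot P) := by
  have h1 : X.IsAutomorphismGroup (sumColouring P fun _ _ : Unit => ()) :=
    (hX.freeProduct (isAutomorphismGroup_trivial _)).of_isomorphic
      (freeProduct_trivial_isomorphic X)
  refine h1.congr (Equiv.optionEquivSumPUnit V).symm fun v hv => ⟨fun h => ?_, fun h => ?_⟩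
  · have hl := h.left_of_sumColouring hv
    have hP := h.comp fun o => o.elim False (Sum.elim id fun _ => False)
    have hroot := (hP.parent hv).not
    refine (hl.prodMk (hl.swap hv)).of_eq (hP.prodMk hroot) fun i j k l h1 h2 => ?_
    simp only [Prod.mk.injEq] at h1 h2
    obtain ⟨h1, h1'⟩ := h1
    obtain ⟨h2, h2'⟩ := h2
    clear hP hroot h hl
    rcases i with i | i <;> rcases j with j | j <;> rcases k with k | k <;> rcases l with l | l <;>
      simp_all [sumColouring, _root_.addRoot, IsRoot]
  · refine Preserves.sumColouring_of_left hv ?_ h ?_ ?_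
    -- The old vertices are exactly those with a parent.
    · refine Preserves.of_eq_zero fun i k hn => (h.parent hv).eq_zero_of_ne hv fun e => hn ?_
      have hnone : ∀ y, ¬ _root_.addRoot P none y := fun y h => h
      have hsome : ∀ i, ∃ k : V ⊕ PUnit, _root_.addRoot P (some i)
          ((Equiv.optionEquivSumPUnit V).symm k) := fun i => by
        by_cases hr : IsRoot P i
        · exact ⟨.inr (), hr⟩
        · simp only [IsRoot, not_forall, not_not] at hr
          obtain ⟨y, hy⟩ := hr
          exact ⟨.inl y, hy⟩
      rcases i with i | i <;> rcases k with k | k <;> simp_all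
    · intro i j k l h
      simpa [_root_.addRoot] using h
    · exact fun _ _ _ _ _ => rfl

/-- If the parts of a disjoint union of two forests are distinguished, its quantum
automorphism group is the free product of those of the parts. -/
theorem IsAutomorphismGroup.sumRel (hX : X.IsAutomorphismGroup P) (hY : Y.IsAutomorphismGroup Q)
    (h : ∀ {B : Type} [Ring B] [StarRing B] [Algebra ℂ B] [StarModule ℂ B]
      (v : Matrix (V ⊕ W) (V ⊕ W) B), IsMagicUnitary v → Preserves v (sumRel P Q) →
        Preserves v fun i (_ : V ⊕ W) => i.isLeft) :
    (QuantumPermutationGroup.freeProduct X Y).IsAutomorphismGroup (sumRel P Q) := by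
  refine (hX.freeProduct hY).congr (.refl _) fun v hv => ⟨fun hs => ?_, fun hs => ?_⟩
  · have := hs.comp fun o => o.elim False (Sum.elim id id)
    convert this using 3 with i j
    rcases i with i | i <;> rcases j with j | j <;> rfl
  · exact Preserves.sumColouring_of_left hv (h v hv hs) hs (fun _ _ _ _ h => h)
      (fun _ _ _ _ h => h)

/-- The smallest family of quantum permutation groups which contains the trivial quantum group and
is closed under free products and wreath products. -/
inductive JordanClosure : QuantumPermutationGroup → Prop
  | isomorphic {X Y : QuantumPermutationGroup} : X.Isomorphic Y → JordanClosure X → JordanClosure Y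
  | trivial : JordanClosure trivial
  | freeProduct {X Y : QuantumPermutationGroup} :
    JordanClosure X → JordanClosure Y → JordanClosure (freeProduct X Y)
  | wreath {X : QuantumPermutationGroup} (n : ℕ) [NeZero n] :
    JordanClosure X → JordanClosure (wreath X n)

end QuantumPermutationGroup

/-! ### Decomposition of rooted forests -/

/-- The restriction of a relation to the elements which satisfy `p`. -/
def restrictRel {V : Type} (P : V → V → Prop) (p : V → Prop) (x y : {v // p v}) : Prop := P x y

theorem IsForest.restrictRel {V : Type} {P : V → V → Prop} (hP : IsForest P) (p : V → Prop) :
    IsForest (restrictRel P p) := hP.comap Subtype.val_injective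

theorem reflTransGen_restrictRel {V : Type} {P : V → V → Prop} {p : V → Prop} {x r : V}
    (h : ReflTransGen P x r) (hp : ∀ y, ReflTransGen P y r → p y) :
    ReflTransGen (restrictRel P p) ⟨x, hp x h⟩ ⟨r, hp r .refl⟩ := by
  induction h using ReflTransGen.head_induction_on with
  | refl => exact .refl
  | head h h' ih => exact .head (show restrictRel P p ⟨_, _⟩ ⟨_, _⟩ from h) ih

/-- The map of `exists_map` is bijective on the children of each vertex. Injectivity follows by
walking up to the roots: equal images have equal parents, hence equal preimages of these parents,
and the image `s` of `r` has no parent. -/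
theorem SameShape.exists_iso {V : Type} {P : V → V → Prop} (hP : IsForest P) {r s : V}
    (hr : IsRoot P r) (hs : IsRoot P s) (h : SameShape P r s) :
    ∃ f : V → V, (∀ x, ReflTransGen P x r → ReflTransGen P (f x) s) ∧
      (∀ x y, ReflTransGen P x r → ReflTransGen P y r → f x = f y → x = y) ∧
      (∀ z, ReflTransGen P z s → ∃ x, ReflTransGen P x r ∧ f x = z) ∧
      ∀ x y, ReflTransGen P x r → ReflTransGen P y r → (P (f x) (f y) ↔ P x y) := by
  obtain ⟨f, hf, hb⟩ := h.exists_map hP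
  have hfwd : ∀ x y, ReflTransGen P y r → P x y → P (f x) (f y) :=
    fun x y hy hxy => (hb y hy).mapsTo hxy
  have hinj : ∀ x y, ReflTransGen P x r → ReflTransGen P y r → f x = f y → x = y := by
    intro x y hx
    induction hx using ReflTransGen.head_induction_on generalizing y with
    | refl =>
      intro hy hxy
      rcases hy.cases_head with rfl | ⟨w, hw, hwr⟩
      · rfl
      · have := hfwd _ _ hwr hw
        rw [← hxy, hf] at this
        exact (hs _ this).elim
    | @head x w hw hwr ih =>
      intro hy hxy
      rcases hy.cases_head with rfl | ⟨w', hw', hwr'⟩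
      · have := hfwd _ _ hwr hw
        rw [hxy, hf] at this
        exact (hs _ this).elim
      · have h1 := hfwd _ _ hwr hw
        have h2 := hfwd _ _ hwr' hw'
        rw [← hxy] at h2
        obtain rfl := ih _ hwr' (hP.unique _ _ _ h1 h2)
        exact (hb w hwr).injOn hw hw' hxy
  refine ⟨f, fun x hx => ?_, hinj, fun z hz => ?_, fun x y hx hy => ⟨fun h => ?_, hfwd x y hy⟩⟩
  · induction hx using ReflTransGen.head_induction_on with
    | refl => rw [hf]
    | head h h' ih => exact ih.head (hfwd _ _ h' h)
  · induction hz using ReflTransGen.head_induction_on with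
    | refl => exact ⟨r, .refl, hf⟩
    | head h _ ih =>
      obtain ⟨x, hx, rfl⟩ := ih
      obtain ⟨y, hy, rfl⟩ := (hb x hx).surjOn h
      exact ⟨y, hx.head hy, rfl⟩
  · obtain ⟨x', hx', hxx⟩ := (hb y hy).surjOn h
    rwa [← hinj x' x (hy.head hx') hx hxx]

namespace QuantumPermutationGroup

variable {V : Type} [Fintype V] {P : V → V → Prop} {X Y : QuantumPermutationGroup}

-- After deletion of `r` the new roots are exactly its former children, so joining them to a point
-- restores `P`.
open Classical in
theorem IsAutomorphismGroup.of_root (hP : IsForest P) {r : V} (hr : IsRoot P r)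
    (h : ∀ s, IsRoot P s → s = r) (hX : X.IsAutomorphismGroup (restrictRel P (· ≠ r))) :
    X.IsAutomorphismGroup P := by
  refine hX.addRoot.of_equiv (Equiv.optionSubtypeNe r) fun i j => ?_
  rcases i with _ | i
  · rcases j with _ | j <;> simp [_root_.addRoot, hr _]
  · rcases j with _ | j
    · have hi : ¬ IsRoot P i.1 := fun h' => i.2 (h _ h')
      simp only [IsRoot, not_forall, not_not] at hi
      obtain ⟨y, hy⟩ := hi
      simp only [_root_.addRoot, IsRoot, Equiv.optionSubtypeNe_some, Equiv.optionSubtypeNe_none,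
        restrictRel, eq_iff_iff, Subtype.forall]
      constructor
      · intro h'
        by_cases hyr : y = r
        · exact hyr ▸ hy
        · exact (h' y hyr hy).elim
      · intro h' z hz hiz
        exact hz (hP.unique _ _ _ hiz h')
    · simp [_root_.addRoot, restrictRel]

-- All components are isomorphic to the tree below `r`, and chosen isomorphisms identify the forest
-- with copies of that tree, one for each root.
open Classical in
theorem IsAutomorphismGroup.of_sameShape (hP : IsForest P) {r : V} (hr : IsRoot P r)
    (h : ∀ s, IsRoot P s → SameShape P r s)
    (hX : X.IsAutomorphismGroup (restrictRel P (ReflTransGen P · r))) :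
    ∃ (n : ℕ) (_ : NeZero n), (QuantumPermutationGroup.wreath X n).IsAutomorphismGroup P := by
  choose f hf hinj hsurj hiff using fun s : {s // IsRoot P s} =>
    (h s s.2).exists_iso hP hr s.2
  let g : {s // IsRoot P s} × {v // ReflTransGen P v r} → V := fun x => f x.1 x.2
  -- A common ancestor lies below a single root, which identifies the copy.
  have hfst : ∀ x y, ∀ z, ReflTransGen P (g x) z → ReflTransGen P (g y) z → x.1 = y.1 :=
    fun x y z hx hy => by
      obtain ⟨t, ht, hzt⟩ := hP.exists_isRoot z
      have h1 := hP.isRoot_unique x.1.2 ht (hf x.1 _ x.2.2) (hx.trans hzt)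
      have h2 := hP.isRoot_unique y.1.2 ht (hf y.1 _ y.2.2) (hy.trans hzt)
      exact Subtype.ext (h1.trans h2.symm)
  have hg : Function.Bijective g := by
    constructor
    · rintro ⟨s, x⟩ ⟨s', y⟩ hxy
      obtain rfl : s = s' := hfst (s, x) (s', y) _ .refl (hxy ▸ .refl)
      rw [Subtype.ext (hinj s _ _ x.2 y.2 hxy)]
    · intro z
      obtain ⟨s, hs, hzs⟩ := hP.exists_isRoot z
      obtain ⟨x, hx, hxz⟩ := hsurj ⟨s, hs⟩ z hzs
      exact ⟨(⟨s, hs⟩, ⟨x, hx⟩), hxz⟩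
  have : Nonempty {v // ReflTransGen P v r} := ⟨⟨r, .refl⟩⟩
  have hn : NeZero (Fintype.card {s // IsRoot P s}) :=
    ⟨(Fintype.card_pos_iff.2 ⟨⟨r, hr⟩⟩).ne'⟩
  refine ⟨Fintype.card {s // IsRoot P s}, hn, ?_⟩
  refine (hX.wreath _).congr (((Fintype.equivFin _).symm.prodCongr (.refl _)).trans
    (Equiv.ofBijective g hg)) fun v hv => ?_
  rw [copiesRel_iff hv (r := ⟨r, .refl⟩) fun x => reflTransGen_restrictRel x.2 fun y hy => hy]
  have key : ∀ x y, P (g x) (g y) ↔ x.1 = y.1 ∧ P x.2 y.2 := by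
    rintro ⟨s, x⟩ ⟨s', y⟩
    constructor
    · intro hxy
      obtain rfl : s = s' := hfst (s, x) (s', y) _ (.single hxy) .refl
      exact ⟨rfl, (hiff s _ _ x.2 y.2).1 hxy⟩
    · rintro ⟨hs, hxy⟩
      obtain rfl : s = s' := hs
      exact (hiff s _ _ x.2 y.2).2 hxy
  have : (fun x y : Fin (Fintype.card {s // IsRoot P s}) × {v // ReflTransGen P v r} =>
      P (g ((Fintype.equivFin _).symm x.1, x.2)) (g ((Fintype.equivFin _).symm y.1, y.2)))
      = copiesRel _ (restrictRel P (ReflTransGen P · r)) := by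
    funext x y
    rw [key]
    simp [copiesRel, restrictRel]
  rw [← this]
  rfl

/-- The condition `hp` makes `p` a union of components, so the forest is the disjoint union of its
restrictions, and `h` distinguishes the two sides. -/
theorem IsAutomorphismGroup.of_split (p : V → Prop) [Fintype {v // p v}]
    [Fintype {v // ¬ p v}] (hp : ∀ x y, P x y → (p x ↔ p y))
    (h : ∀ {B : Type} [Ring B] [StarRing B] [Algebra ℂ B] [StarModule ℂ B]
      (v : Matrix V V B), IsMagicUnitary v → Preserves v P → Preserves v fun i (_ : V) => p i)
    (hX : X.IsAutomorphismGroup (restrictRel P p))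
    (hY : Y.IsAutomorphismGroup (restrictRel P fun v => ¬ p v)) :
    (QuantumPermutationGroup.freeProduct X Y).IsAutomorphismGroup P := by
  classical
  have he : ∀ i j, _root_.sumRel (restrictRel P p) (restrictRel P fun v => ¬ p v) i j
      = P (Equiv.sumCompl p i) (Equiv.sumCompl p j) := fun i j => by
    rcases i with i | i <;> rcases j with j | j
    · rfl
    · simpa [_root_.sumRel] using fun h => j.2 ((hp _ _ h).1 i.2)
    · simpa [_root_.sumRel] using fun h => i.2 ((hp _ _ h).2 j.2)
    · rfl
  refine (hX.sumRel hY fun v hv hs => ?_).of_equiv (Equiv.sumCompl p) he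
  have h1 : Preserves (v.submatrix (Equiv.sumCompl p).symm (Equiv.sumCompl p).symm) P := by
    have := hs.submatrix (Equiv.sumCompl p).symm
    simpa only [he, Equiv.apply_symm_apply] using this
  have h2 := ((h _ (hv.reindex _) h1).submatrix (Equiv.sumCompl p)).comp fun q => decide q
  have h3 : (v.submatrix (Equiv.sumCompl p).symm (Equiv.sumCompl p).symm).submatrix
      (Equiv.sumCompl p) (Equiv.sumCompl p) = v := by ext; simp
  rw [h3] at h2
  convert h2 using 3 with i j
  rcases i with i | i <;> simp [i.2]

end QuantumPermutationGroup

open QuantumPermutationGroup in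
/-- The quantum automorphism group of a finite rooted forest can be obtained from the trivial
quantum group by free products and wreath products. -/
theorem IsForest.exists_jordanClosure {V : Type} [Fintype V] {P : V → V → Prop}
    (hP : IsForest P) : ∃ X, JordanClosure X ∧ X.IsAutomorphismGroup P := by
  classical
  induction hn : Fintype.card V using Nat.strong_induction_on generalizing V with
  | _ n ih =>
  subst hn
  have ih' : ∀ (p : V → Prop) [Fintype {v // p v}], (∃ v, ¬ p v) →
      ∃ X, JordanClosure X ∧ X.IsAutomorphismGroup (_root_.restrictRel P p) :=
    fun p _ ⟨v, hv⟩ => ih _ (Fintype.card_subtype_lt hv) (hP.restrictRel p) rfl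
  rcases isEmpty_or_nonempty V with hV | ⟨⟨x⟩⟩
  · exact ⟨_, .trivial, isAutomorphismGroup_trivial P⟩
  obtain ⟨r, hr, -⟩ := hP.exists_isRoot x
  by_cases h1 : ∀ s, IsRoot P s → s = r
  · obtain ⟨X, hX, hX'⟩ := ih' (· ≠ r) ⟨r, by simp⟩
    exact ⟨X, hX, hX'.of_root hP hr h1⟩
  -- There are several roots from here on, so the tree below `r` omits a vertex and induction
  -- applies to it.
  by_cases h2 : ∀ s, IsRoot P s → SameShape P r s
  · push Not at h1
    obtain ⟨s, hs, hsr⟩ := h1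
    obtain ⟨X, hX, hX'⟩ := ih' (ReflTransGen P · r) ⟨s, fun h => hsr (eq_of_isRoot hs h)⟩
    obtain ⟨n, hn, h⟩ := hX'.of_sameShape hP hr h2
    exact ⟨_, hX.wreath n, h⟩
  · push Not at h2
    obtain ⟨s, hs, hsr⟩ := h2
    -- `p` selects the trees shaped like the one at `r`. Both parts are strictly smaller: `s` lies
    -- outside `p` and `r` inside it.
    let p : V → Prop := fun v => ∃ t, ReflTransGen P v t ∧ IsRoot P t ∧ SameShape P t r
    obtain ⟨X, hX, hX'⟩ := ih' p ⟨s, fun ⟨t, hst, ht, htr⟩ => by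
      obtain rfl := eq_of_isRoot hs hst
      exact hsr htr.symm⟩
    obtain ⟨Y, hY, hY'⟩ := ih' (fun v => ¬ p v)
      ⟨r, not_not.2 ⟨r, .refl, hr, .refl hP.wellFounded r⟩⟩
    refine ⟨_, hX.freeProduct hY, hX'.of_split p (fun x y hxy => ?_) (fun v hv hvP => ?_) hY'⟩
    · constructor
      · rintro ⟨t, hxt, ht, htr⟩
        rcases hxt.cases_head with rfl | ⟨z, hz, hzt⟩
        · exact (ht _ hxy).elim
        · exact ⟨t, hP.unique _ _ _ hz hxy ▸ hzt, ht, htr⟩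
      · rintro ⟨t, hyt, ht, htr⟩
        exact ⟨t, hyt.head hxy, ht, htr⟩
    -- Entries between different shapes vanish, so having the shape of `r` is preserved; then so is
    -- lying below a root with that shape.
    · have hs : Preserves v fun i (_ : V) => SameShape P i r :=
        Preserves.of_eq_zero fun i k hik =>
          SameShape.eq_zero_of_not hP.wellFounded hv hvP i k fun h =>
            hik (propext ⟨h.symm.trans, h.trans⟩)
      exact (hvP.reflTransGen hv).relComp hv ((hvP.isRoot hv).and hs)

/-! ## Trees and rooted forests -/

namespace SimpleGraph

variable {V : Type} {G : SimpleGraph V}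

theorem relPow_adj_iff {i j : V} {n : ℕ} :
    Preserves.relPow G.Adj n i j ↔ ∃ p : G.Walk i j, p.length = n := by
  induction n generalizing j with
  | zero =>
    constructor
    · rintro rfl; exact ⟨.nil, rfl⟩
    · rintro ⟨p, hp⟩; exact Walk.eq_of_length_eq_zero hp
  | succ n ih =>
    constructor
    · rintro ⟨k, hk, h⟩
      obtain ⟨p, hp⟩ := ih.1 hk
      exact ⟨p.concat h, by simp [hp]⟩
    · rintro ⟨p, hp⟩
      have hp' : ¬ p.Nil := fun h => by simp [Walk.length_eq_zero_iff.2 h] at hp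
      exact ⟨p.penultimate, ih.2 ⟨p.dropLast, by simp [hp]⟩, p.adj_penultimate hp'⟩

/-- The distance is determined by the set of lengths of walks, and walks of length `n` form the
`n`-th power of adjacency. -/
theorem preserves_dist [Fintype V] {A : Type*} [Ring A] [StarRing A] [Algebra ℂ A] [StarModule ℂ A]
    {u : Matrix V V A} (hu : IsMagicUnitary u) (h : Preserves u G.Adj) : Preserves u G.dist := by
  intro i j k l hn
  by_contra h0
  refine hn ?_
  have h1 : ∀ n, (∃ p : G.Walk i j, p.length = n) ↔ ∃ p : G.Walk k l, p.length = n := fun n => by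
    rw [← relPow_adj_iff, ← relPow_adj_iff]
    by_contra h2
    exact h0 (Preserves.relPow_preserves hu h n i j k l fun e => h2 (Iff.of_eq e))
  rw [dist_eq_sInf, dist_eq_sInf]
  congr 1
  ext n
  exact h1 n

/-- The sum of the distances from a vertex to all the vertices. -/
noncomputable def distSum [Fintype V] (G : SimpleGraph V) (v : V) : ℕ := ∑ w, G.dist w v

theorem preserves_distSum [Fintype V] {A : Type*} [Ring A] [StarRing A] [Algebra ℂ A]
    [StarModule ℂ A] {u : Matrix V V A} (hu : IsMagicUnitary u) (h : Preserves u G.Adj) :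
    Preserves u fun i (_ : V) => G.distSum i := by
  have h1 := Preserves.matrix_mul hu (M := fun i j => (G.dist i j : ℂ)) (N := fun _ _ => 1)
    ((preserves_dist hu h).comp fun n => (n : ℂ)) (Preserves.const _)
  intro i j k l hn
  refine h1 i j k l fun e => hn ?_
  replace e : ∑ w, (G.dist i w : ℂ) * 1 = ∑ w, (G.dist k w : ℂ) * 1 := e
  simp only [mul_one] at e
  simp only [distSum, G.dist_comm (v := i), G.dist_comm (v := k)]
  exact_mod_cast e

/-! ### Convexity of the distance sum on a tree -/

namespace IsTree

/-- Geodesics from `w` to `x` and to `y`, prolonged to `z`, are both the unique path from `w` to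
`z`, so they have the same penultimate vertex. -/
theorem eq_of_dist_add_one (hG : G.IsTree) {w x y z : V} (hx : G.Adj x z) (hy : G.Adj y z)
    (h : G.dist w z = G.dist w x + 1) (h' : G.dist w z = G.dist w y + 1) : x = y := by
  obtain ⟨p, hp⟩ := hG.connected.exists_walk_length_eq_dist w x
  obtain ⟨q, hq⟩ := hG.connected.exists_walk_length_eq_dist w y
  have hp' : (p.concat hx).IsPath := Walk.isPath_of_length_eq_dist _ (by simp [hp, h])
  have hq' : (q.concat hy).IsPath := Walk.isPath_of_length_eq_dist _ (by simp [hq, h'])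
  have := (hG.existsUnique_path w z).unique hp' hq'
  have := congrArg Walk.penultimate this
  simpa using this

/-- At most one neighbour of `z` is closer to `w` than `z` is, so the inequality holds weakly for
each `w`; it is strict at `w = z`. Consequently at most one neighbour of `z` has a value not
exceeding that of `z`, which yields unique parents. -/
theorem distSum_convex [Fintype V] (hG : G.IsTree) {x y z : V} (hx : G.Adj x z) (hy : G.Adj y z)
    (hxy : x ≠ y) : 2 * G.distSum z < G.distSum x + G.distSum y := by
  rw [distSum, distSum, distSum, ← Finset.sum_add_distrib, Finset.mul_sum]
  refine Finset.sum_lt_sum (fun w _ => ?_) ⟨z, Finset.mem_univ _, ?_⟩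
  · rcases hG.dist_eq_dist_add_one_of_adj w hx with h | h <;>
      rcases hG.dist_eq_dist_add_one_of_adj w hy with h' | h'
    · omega
    · omega
    · omega
    · exact (hxy (hG.eq_of_dist_add_one hx hy h h')).elim
  · simp [dist_eq_one_iff_adj.2 hx.symm, dist_eq_one_iff_adj.2 hy.symm]

end IsTree

/-- The orientation of the edges along which `distSum` decreases. -/
def medianRel [Fintype V] (G : SimpleGraph V) (x y : V) : Prop :=
  G.Adj x y ∧ G.distSum y < G.distSum x

theorem preserves_medianRel [Fintype V] {A : Type*} [Ring A] [StarRing A] [Algebra ℂ A]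
    [StarModule ℂ A] {u : Matrix V V A} (hu : IsMagicUnitary u) (h : Preserves u G.Adj) :
    Preserves u G.medianRel := by
  have h1 := preserves_distSum hu h
  exact h.and ((h1.prodMk (h1.swap hu)).comp fun p => p.2 < p.1)

namespace IsTree

variable [Fintype V]

theorem isForest_medianRel (hG : G.IsTree) : IsForest G.medianRel where
  unique x y z hy hz := by
    by_contra hn
    have := hG.distSum_convex hy.1.symm hz.1.symm hn
    have := hy.2
    have := hz.2
    omega
  exists_rank := ⟨G.distSum, fun _ _ h => h.2⟩

/-- After a step along which the sum does not decrease, convexity makes it strictly increase at each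
further step. If there is a further step, the end `b` thus has a neighbour with a smaller sum. -/
theorem not_isRoot_of_isPath (hG : G.IsTree) {a c b : V} (hac : G.Adj a c) (p : G.Walk c b)
    (hp : p.IsPath) (ha : a ∉ p.support) (hle : G.distSum a ≤ G.distSum c) :
    c = b ∨ ¬ IsRoot G.medianRel b := by
  induction p generalizing a with
  | nil => exact .inl rfl
  | @cons c d b h q ih =>
    rw [Walk.cons_isPath_iff] at hp
    have had : a ≠ d := by
      rintro rfl
      exact ha (by simp)
    have := hG.distSum_convex hac h.symm had
    refine .inr ?_
    rcases ih h hp.1 hp.2 (by omega) with rfl | h'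
    · exact fun hr => hr c ⟨h.symm, by omega⟩
    · exact h'

theorem adj_of_isRoot (hG : G.IsTree) {i j : V} (hi : IsRoot G.medianRel i)
    (hj : IsRoot G.medianRel j) (hij : i ≠ j) : G.Adj i j := by
  obtain ⟨p, hp, -⟩ := hG.existsUnique_path i j
  cases p with
  | nil => exact (hij rfl).elim
  | cons h q =>
    rw [Walk.cons_isPath_iff] at hp
    rcases hG.not_isRoot_of_isPath h q hp.1 hp.2 (not_lt.1 fun hlt => hi _ ⟨h, hlt⟩) with rfl | h'
    · exact h
    · exact (h' hj).elim

/-- By convexity, an edge with equal sums at its ends leaves no smaller neighbour at either end, so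
it joins two roots. Distinct roots are always adjacent, so the formula recovers adjacency from the
forest. -/
theorem adj_iff_medianRel (hG : G.IsTree) {i j : V} : G.Adj i j ↔
    (G.medianRel i j ∨ G.medianRel j i) ∨
      i ≠ j ∧ IsRoot G.medianRel i ∧ IsRoot G.medianRel j := by
  constructor
  · intro h
    rcases lt_trichotomy (G.distSum i) (G.distSum j) with hlt | he | hlt
    · exact .inl (.inr ⟨h.symm, hlt⟩)
    · have key : ∀ {i j}, G.Adj i j → G.distSum i = G.distSum j → IsRoot G.medianRel i :=
        fun {i j} h he y hy => by
          have hyj : y ≠ j := by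
            rintro rfl
            exact hy.2.ne he.symm
          have := hG.distSum_convex hy.1.symm h.symm hyj
          have := hy.2
          omega
      exact .inr ⟨h.ne, key h he, key h.symm he.symm⟩
    · exact .inl (.inl ⟨h, hlt⟩)
  · rintro ((h | h) | ⟨h, hi, hj⟩)
    · exact h.1
    · exact h.1.symm
    · exact hG.adj_of_isRoot hi hj h

theorem exists_jordanClosure (hG : G.IsTree) :
    ∃ X, QuantumPermutationGroup.JordanClosure X ∧ X.IsAutomorphismGroup G.Adj := by
  obtain ⟨X, hX, hX'⟩ := hG.isForest_medianRel.exists_jordanClosure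
  refine ⟨X, hX, hX'.congr (.refl V) fun v hv => ⟨fun h => ?_, preserves_medianRel hv⟩⟩
  have h1 := h.isRoot hv
  have := (h.or (h.swap hv)).or ((Preserves.eq hv).not.and (h1.and (h1.swap hv)))
  change Preserves v G.Adj
  simpa only [← hG.adj_iff_medianRel] using this

end IsTree

end SimpleGraph

/-! ### The graph underlying a rooted forest -/

namespace IsForest

variable {V : Type} {P : V → V → Prop}

theorem irrefl (hP : IsForest P) (x : V) : ¬ P x x := fun h => hP.not_reflTransGen h .refl

/-- The graph whose edges join the vertices of a forest to their parents. -/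
def graph (hP : IsForest P) : SimpleGraph V where
  Adj x y := P x y ∨ P y x
  symm := ⟨fun _ _ h => h.symm⟩
  loopless := ⟨fun x h => hP.irrefl x (h.elim id id)⟩

theorem crossing (hP : IsForest P) {x y a c : V} (hxy : P x y) (hac : hP.graph.Adj a c)
    (ha : ¬ ReflTransGen P a x) (hc : ReflTransGen P c x) : a = y ∧ c = x := by
  rcases hac with h | h
  · exact (ha (hc.head h)).elim
  · rcases hc.cases_head with rfl | ⟨z, hz, hzx⟩
    · exact ⟨hP.unique _ _ _ h hxy, rfl⟩
    · exact (ha (hP.unique _ _ _ h hz ▸ hzx)).elim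

/-- By `crossing`, the set of descendants of `x` can be entered from outside only along the edge
from `y` to `x`, so the walk visits `y` and then takes at least one more step. -/
theorem dist_add_one_le (hP : IsForest P) (hc : hP.graph.Connected) {x y a b : V} (hxy : P x y)
    (p : hP.graph.Walk a b) (ha : ¬ ReflTransGen P a x) (hb : ReflTransGen P b x) :
    hP.graph.dist a y + 1 ≤ p.length := by
  induction p with
  | nil => exact (ha hb).elim
  | @cons a c b h q ih =>
    by_cases hcx : ReflTransGen P c x
    · obtain ⟨rfl, -⟩ := hP.crossing hxy h ha hcx
      simp
    · have h1 := ih hcx hb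
      have h2 := hc.dist_triangle (u := a) (v := c) (w := y)
      rw [SimpleGraph.dist_eq_one_iff_adj.2 h] at h2
      rw [SimpleGraph.Walk.length_cons]
      omega

theorem connected_graph (hP : IsForest P) {r : V} (hr : ∀ x, ReflTransGen P x r) :
    hP.graph.Connected := by
  have : ∀ x, hP.graph.Reachable x r := fun x => by
    induction hr x using ReflTransGen.head_induction_on with
    | refl => rfl
    | head h _ ih => exact (SimpleGraph.Adj.reachable (G := hP.graph) (.inl h)).trans ih
  have hV := Nonempty.intro r
  exact ⟨fun x y => (this x).trans (this y).symm⟩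

theorem mem_edges (hP : IsForest P) {x y a b : V} (hxy : P x y) (p : hP.graph.Walk a b)
    (ha : ¬ ReflTransGen P a x) (hb : ReflTransGen P b x) : s(y, x) ∈ p.edges := by
  induction p with
  | nil => exact (ha hb).elim
  | @cons a c b h q ih =>
    rw [SimpleGraph.Walk.edges_cons, List.mem_cons]
    by_cases hcx : ReflTransGen P c x
    · obtain ⟨rfl, rfl⟩ := hP.crossing hxy h ha hcx
      exact .inl rfl
    · exact .inr (ih hcx hb)

/-- The same entrance argument shows that every edge to a parent is a bridge. -/
theorem isTree_graph (hP : IsForest P) {r : V} (hr : ∀ x, ReflTransGen P x r) :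
    hP.graph.IsTree := by
  have key : ∀ {x y}, P x y → hP.graph.IsBridge s(y, x) := fun {x y} h =>
    SimpleGraph.isBridge_iff_forall_walk_mem_edges.2 fun p =>
      hP.mem_edges h p (hP.not_reflTransGen h) .refl
  refine ⟨hP.connected_graph hr, SimpleGraph.isAcyclic_iff_forall_adj_isBridge.2 fun x y h => ?_⟩
  rcases h with h | h
  · rw [Sym2.eq_swap]; exact key h
  · exact key h

/-- Moving from `x` to its parent `y` lengthens distances from descendants of `x` by at most one and
shortens all the others by at least one; the others are the majority. -/
theorem distSum_lt [Fintype V] (hP : IsForest P) (hc : hP.graph.Connected) {x y : V}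
    (hxy : P x y) (hx : 2 * Nat.card {z // ReflTransGen P z x} < Nat.card V) :
    hP.graph.distSum y < hP.graph.distSum x := by
  classical
  have h1 : ∑ w, (hP.graph.dist w y + if ReflTransGen P w x then 0 else 1)
      ≤ ∑ w, (hP.graph.dist w x + if ReflTransGen P w x then 1 else 0) := by
    refine Finset.sum_le_sum fun w _ => ?_
    split_ifs with h
    · have := hc.dist_triangle (u := w) (v := x) (w := y)
      have hadj : hP.graph.Adj x y := .inl hxy
      rw [SimpleGraph.dist_eq_one_iff_adj.2 hadj] at this
      exact this
    · obtain ⟨p, hp⟩ := hc.exists_walk_length_eq_dist w x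
      have := hP.dist_add_one_le hc hxy p h .refl
      omega
  rw [Finset.sum_add_distrib, Finset.sum_add_distrib] at h1
  have h2 : ∑ w, ((if ReflTransGen P w x then 0 else 1) + if ReflTransGen P w x then 1 else 0)
      = Fintype.card V := by
    rw [← Finset.card_univ, Finset.card_eq_sum_ones]
    exact Finset.sum_congr rfl fun w _ => by split_ifs <;> rfl
  rw [Finset.sum_add_distrib] at h2
  have h3 : ∑ w, (if ReflTransGen P w x then 1 else 0)
      = Fintype.card {z // ReflTransGen P z x} := by
    rw [Fintype.card_subtype, Finset.sum_boole, Nat.cast_id]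
  rw [Nat.card_eq_fintype_card, Nat.card_eq_fintype_card] at hx
  unfold SimpleGraph.distSum
  omega

end IsForest

/-- Under the size condition the forest relation is the median orientation of its own graph, hence
definable from adjacency. -/
theorem QuantumPermutationGroup.IsAutomorphismGroup.graph {V : Type} [Fintype V]
    {P : V → V → Prop} {X : QuantumPermutationGroup} (hX : X.IsAutomorphismGroup P)
    (hP : IsForest P) (hc : hP.graph.Connected)
    (h : ∀ x y, P x y → 2 * Nat.card {z // ReflTransGen P z x} < Nat.card V) :
    X.IsAutomorphismGroup hP.graph.Adj := by
  refine hX.congr (.refl V) fun v hv => ⟨fun h => h.or (h.swap hv), fun h' => ?_⟩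
  have : P = hP.graph.medianRel := by
    funext x y
    refine propext ⟨fun hxy => ⟨.inl hxy, hP.distSum_lt hc hxy (h x y hxy)⟩, fun hxy => ?_⟩
    rcases hxy.1 with hxy' | hyx
    · exact hxy'
    · exact absurd (hP.distSum_lt hc hyx (h y x hyx)) hxy.2.not_gt
  rw [this]
  exact SimpleGraph.preserves_medianRel hv h'

/-! ## Trees with prescribed quantum automorphism groups -/

/-- The number of descendants of a vertex of a forest, including the vertex itself. -/
noncomputable def descCard {V : Type} (P : V → V → Prop) (x : V) : ℕ :=
  Nat.card {z // ReflTransGen P z x}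

theorem descCard_le_of_reflTransGen {V : Type} [Finite V] {P : V → V → Prop} {x y : V}
    (h : ReflTransGen P x y) : descCard P x ≤ descCard P y :=
  Nat.card_le_card_of_injective (fun z => ⟨z.1, z.2.trans h⟩)
    fun _ _ h => Subtype.ext (Subtype.mk.inj h)

theorem descCard_eq_of_forall {V : Type} {P : V → V → Prop} {x : V}
    (h : ∀ z, ReflTransGen P z x) : descCard P x = Nat.card V :=
  Nat.card_congr (Equiv.subtypeUnivEquiv h)

/-- By `hr` the image of `f` is closed under passing to children, so no descendant of `f x` escapes
it. -/
theorem descCard_apply {V W : Type} {P : V → V → Prop} {Q : W → W → Prop} {f : V → W}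
    (hf : Function.Injective f) (hPQ : ∀ x y, Q (f x) (f y) ↔ P x y)
    (hr : ∀ a y, Q a (f y) → a ∈ Set.range f) (x : V) : descCard Q (f x) = descCard P x := by
  have h1 : ∀ z, ReflTransGen P z x → ReflTransGen Q (f z) (f x) := fun z h =>
    h.lift f fun a b => (hPQ a b).2
  refine (Nat.card_eq_of_bijective (fun z : {z // ReflTransGen P z x} =>
    (⟨f z.1, h1 _ z.2⟩ : {z // ReflTransGen Q z (f x)})) ⟨fun a b h => ?_, ?_⟩).symm
  · exact Subtype.ext (hf (congrArg Subtype.val h))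
  · rintro ⟨z, hz⟩
    suffices ∃ y, ReflTransGen P y x ∧ f y = z by
      obtain ⟨y, hy, rfl⟩ := this
      exact ⟨⟨y, hy⟩, rfl⟩
    induction hz using ReflTransGen.head_induction_on with
    | refl => exact ⟨x, .refl, rfl⟩
    | head h _ ih =>
      obtain ⟨y, hy, rfl⟩ := ih
      obtain ⟨w, rfl⟩ := hr _ _ h
      exact ⟨w, hy.head ((hPQ _ _).1 h), rfl⟩

theorem Preserves.descCard {V : Type} [Fintype V] {A : Type*} [Ring A] [StarRing A] [Algebra ℂ A]
    [StarModule ℂ A] {u : Matrix V V A} {P : V → V → Prop} (hu : IsMagicUnitary u)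
    (h : Preserves u P) : Preserves u fun i (_ : V) => descCard P i := by
  classical
  have := ((h.reflTransGen hu).swap hu).card hu (Preserves.const True)
  convert this using 3 with i j
  rw [_root_.descCard, Nat.card_eq_fintype_card, Fintype.card_subtype]
  simp

namespace IsForest

variable {V W : Type} {P : V → V → Prop} {Q : W → W → Prop}

theorem addRoot (hP : IsForest P) : IsForest (addRoot P) where
  unique x y z hy hz := by
    rcases x with _ | x
    · exact hy.elim
    rcases y with _ | y <;> rcases z with _ | z
    · rfl
    · exact (hy z hz).elim
    · exact (hz y hy).elim
    · exact congrArg some (hP.unique _ _ _ hy hz)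
  exists_rank := by
    obtain ⟨rank, hr⟩ := hP.exists_rank
    refine ⟨fun x => x.elim 0 fun x => rank x + 1, fun x y h => ?_⟩
    rcases x with _ | x
    · exact h.elim
    rcases y with _ | y
    · simp
    · simpa using hr _ _ h

theorem reflTransGen_addRoot (hP : IsForest P) (x : Option V) :
    ReflTransGen (_root_.addRoot P) x none := by
  rcases x with _ | x
  · rfl
  · obtain ⟨r, hr, hxr⟩ := hP.exists_isRoot x
    exact (hxr.lift (p := _root_.addRoot P) some fun _ _ h => h).tail hr

theorem sumRel (hP : IsForest P) (hQ : IsForest Q) : IsForest (sumRel P Q) where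
  unique x y z hy hz := by
    rcases x with x | x <;> rcases y with y | y <;> rcases z with z | z <;>
      simp only [_root_.sumRel] at hy hz
    · exact congrArg _ (hP.unique _ _ _ hy hz)
    · exact congrArg _ (hQ.unique _ _ _ hy hz)
  exists_rank := by
    obtain ⟨rank, hr⟩ := hP.exists_rank
    obtain ⟨rank', hr'⟩ := hQ.exists_rank
    refine ⟨Sum.elim rank rank', fun x y h => ?_⟩
    rcases x with x | x <;> rcases y with y | y <;> simp only [_root_.sumRel] at h
    · exact hr _ _ h
    · exact hr' _ _ h

theorem copiesRel (hP : IsForest P) (N : Type) : IsForest (copiesRel N P) where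
  unique _ _ _ hy hz := Prod.ext (hy.1.symm.trans hz.1) (hP.unique _ _ _ hy.2 hz.2)
  exists_rank := by
    obtain ⟨rank, hr⟩ := hP.exists_rank
    exact ⟨fun x => rank x.2, fun _ _ h => hr _ _ h.2⟩

end IsForest

section sumRel

variable {V W : Type} {P : V → V → Prop} {Q : W → W → Prop}

theorem isRoot_inl {x : V} : IsRoot (sumRel P Q) (.inl x) ↔ IsRoot P x := by
  simp [IsRoot, sumRel]

theorem isRoot_inr {x : W} : IsRoot (sumRel P Q) (.inr x) ↔ IsRoot Q x := by
  simp [IsRoot, sumRel]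

theorem descCard_inl (x : V) : descCard (sumRel P Q) (.inl x) = descCard P x :=
  descCard_apply Sum.inl_injective (fun _ _ => Iff.rfl)
    (by rintro (a | a) y h <;> simp_all [sumRel]) x

theorem descCard_inr (x : W) : descCard (sumRel P Q) (.inr x) = descCard Q x :=
  descCard_apply Sum.inr_injective (fun _ _ => Iff.rfl)
    (by rintro (a | a) y h <;> simp_all [sumRel]) x

theorem descCard_some (x : V) : descCard (addRoot P) (some x) = descCard P x :=
  descCard_apply (Option.some_injective V) (fun _ _ => Iff.rfl)
    (by rintro (_ | a) y h <;> simp_all [addRoot]) x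

theorem isLeft_of_reflTransGen {a b : V ⊕ W} (h : ReflTransGen (sumRel P Q) a b) :
    a.isLeft = b.isLeft := by
  induction h with
  | refl => rfl
  | @tail b c _ h ih =>
    rw [ih]
    rcases b with b | b <;> rcases c with c | c <;> simp_all [sumRel]

end sumRel

/-! ### Realising the closure by forests with controlled sizes -/

namespace QuantumPermutationGroup

/-- `X` is the quantum automorphism group of a rooted forest with `n` vertices, whose trees have
numbers of vertices which belong to `S`. -/
def HasForest (X : QuantumPermutationGroup) (S : Set ℕ) (n : ℕ) : Prop :=
  ∃ (V : Type) (_ : Fintype V) (P : V → V → Prop), IsForest P ∧ X.IsAutomorphismGroup P ∧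
    Nat.card V = n ∧ ∀ r, IsRoot P r → descCard P r ∈ S

namespace HasForest

variable {X Y : QuantumPermutationGroup} {S T : Set ℕ} {m n : ℕ}

theorem of_isomorphic (h : X.HasForest S n) (e : X.Isomorphic Y) : Y.HasForest S n := by
  obtain ⟨V, _, P, hP, hX, hn⟩ := h
  exact ⟨V, _, P, hP, hX.of_isomorphic e, hn⟩

/-- Joining the roots turns a forest into a single tree and raises its size by one, with the same
quantum group. It restores the size information that other constructions lose. -/
theorem addRoot (h : X.HasForest S n) : X.HasForest {n + 1} (n + 1) := by
  obtain ⟨V, _, P, hP, hX, rfl, -⟩ := h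
  refine ⟨Option V, inferInstance, _root_.addRoot P, hP.addRoot, hX.addRoot, by simp,
    fun r hr => ?_⟩
  rw [IsForest.eq_of_isRoot hr (hP.reflTransGen_addRoot r),
    descCard_eq_of_forall hP.reflTransGen_addRoot]
  simp

/-- The number of descendants of its root tells to which part a vertex belongs, as `S` and `T` are
disjoint. -/
theorem freeProduct (hX : X.HasForest S m) (hY : Y.HasForest T n) (h : Disjoint S T) :
    (freeProduct X Y).HasForest (S ∪ T) (m + n) := by
  obtain ⟨V, _, P, hP, hX, rfl, hS⟩ := hX
  obtain ⟨W, _, Q, hQ, hY, rfl, hT⟩ := hY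
  refine ⟨V ⊕ W, inferInstance, sumRel P Q, hP.sumRel hQ, hX.sumRel hY fun v hv hs => ?_,
    Nat.card_sum, ?_⟩
  · have h1 : Preserves v fun i (_ : V ⊕ W) => descCard (sumRel P Q) i ∈ S :=
      (hs.descCard hv).comp (· ∈ S)
    have h2 := (hs.reflTransGen hv).relComp hv ((hs.isRoot hv).and h1)
    have key : ∀ i : V ⊕ W, i.isLeft = true ↔ ∃ k, ReflTransGen (sumRel P Q) i k ∧
        IsRoot (sumRel P Q) k ∧ descCard (sumRel P Q) k ∈ S := fun i => ?_
    · exact h2.of_eq h2 fun i j k l e _ =>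
        Bool.eq_iff_iff.2 ((key i).trans ((Iff.of_eq e).trans (key k).symm))
    obtain ⟨r, hr, hir⟩ := (hP.sumRel hQ).exists_isRoot i
    constructor
    · intro hi
      rw [isLeft_of_reflTransGen hir] at hi
      obtain ⟨x, rfl⟩ := Sum.isLeft_iff.1 hi
      exact ⟨_, hir, hr, by rw [descCard_inl]; exact hS x (isRoot_inl.1 hr)⟩
    · rintro ⟨k, hik, hk, hkS⟩
      rw [isLeft_of_reflTransGen hik]
      rcases k with x | x
      · rfl
      · rw [descCard_inr] at hkS
        exact (Set.disjoint_left.1 h hkS (hT x (isRoot_inr.1 hk))).elim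
  · rintro (r | r) hr
    · rw [descCard_inl]
      exact .inl (hS r (isRoot_inl.1 hr))
    · rw [descCard_inr]
      exact .inr (hT r (isRoot_inr.1 hr))

theorem wreath (hX : X.HasForest {n} n) (hn : n ≠ 0) (k : ℕ) [NeZero k] :
    (wreath X k).HasForest Set.univ (k * n) := by
  obtain ⟨V, _, P, hP, hX, rfl, hS⟩ := hX
  have hV : Nonempty V := (Nat.card_ne_zero.1 hn).1
  obtain ⟨r, hr, -⟩ := hP.exists_isRoot hV.some
  -- A root with as many descendants as there are vertices lies above everything: the forest is one
  -- tree, as `copiesRel_iff` requires.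
  have hall : ∀ x, ReflTransGen P x r := fun x => by
    by_contra hx
    have : descCard P r < Nat.card V := Finite.card_subtype_lt hx
    exact this.ne (hS r hr)
  exact ⟨Fin k × V, inferInstance, copiesRel (Fin k) P, hP.copiesRel _,
    (hX.wreath k).congr (.refl _) fun v hv => copiesRel_iff hv hall, by simp,
    fun _ _ => Set.mem_univ _⟩

/-- The forest constructed is a path rooted at one end, and it is rigid. -/
theorem of_trivial (n : ℕ) : trivial.HasForest {n + 1} (n + 1) := by
  induction n with
  | zero =>
    refine ⟨Unit, inferInstance, fun _ _ => False, ⟨by simp, 0, by simp⟩,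
      isAutomorphismGroup_trivial _, by simp, fun r hr => ?_⟩
    rw [descCard_eq_of_forall fun _ => .refl]
    simp
  | succ n ih => exact ih.addRoot

theorem of_jordanClosure (h : JordanClosure X) : ∃ n, X.HasForest {n + 1} (n + 1) := by
  induction h with
  | isomorphic e _ ih =>
    obtain ⟨n, ih⟩ := ih
    exact ⟨n, ih.of_isomorphic e⟩
  | trivial => exact ⟨0, of_trivial 0⟩
  | freeProduct _ _ ih ih' =>
    obtain ⟨m, ih⟩ := ih
    obtain ⟨n, ih'⟩ := ih'
    -- Trees of equal size could be exchanged; an extra root on the second makes the sizes differ.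
    by_cases hmn : m = n
    · exact ⟨_, (ih.freeProduct ih'.addRoot (by simp [hmn])).addRoot⟩
    · exact ⟨_, (ih.freeProduct ih' (by simpa using hmn)).addRoot⟩
  | wreath k _ ih =>
    obtain ⟨n, ih⟩ := ih
    exact ⟨_, (ih.wreath n.succ_ne_zero k).addRoot⟩

/-- With the new root there are `n + 1` vertices, and each branch has fewer than half of them, so
forgetting the root loses nothing. -/
theorem mem_treeFamily (h : X.HasForest S n) (hS : ∀ s ∈ S, 2 * s < n + 1) :
    X ∈ treeFamily := by
  obtain ⟨V, _, P, hP, hX, rfl, hr⟩ := h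
  have hT := hP.addRoot.isTree_graph hP.reflTransGen_addRoot
  have : X.IsAutomorphismGroup hP.addRoot.graph.Adj := by
    refine hX.addRoot.graph hP.addRoot hT.connected fun x y hxy => ?_
    rcases x with _ | x
    · exact hxy.elim
    obtain ⟨r, hroot, hxr⟩ := hP.exists_isRoot x
    have h1 := hS _ (hr r hroot)
    have h2 := descCard_le_of_reflTransGen hxr
    have h3 : Nat.card {z // ReflTransGen (_root_.addRoot P) z (some x)} = descCard P x :=
      descCard_some x
    rw [h3, Finite.card_option]
    omega
  exact ⟨Option V, inferInstance, inferInstance, hP.addRoot.graph, hT,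
    (isAutomorphismGroup_ofGraph _).isomorphic this⟩

end HasForest

theorem mem_treeFamily_iff {X : QuantumPermutationGroup} : X ∈ treeFamily ↔ JordanClosure X := by
  constructor
  · rintro ⟨V, _, _, T, hT, e⟩
    obtain ⟨Y, hY, hY'⟩ := hT.exists_jordanClosure
    exact .isomorphic ((hY'.isomorphic (isAutomorphismGroup_ofGraph T)).trans e) hY
  · intro h
    obtain ⟨n, h⟩ := HasForest.of_jordanClosure h
    -- Rooted paths with `n + 2` and `n + 3` vertices are put beside the tree with `n + 1` vertices.
    -- The sizes are distinct, and with the final root the total is `3 * n + 7`, more than twice the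
    -- largest branch.
    have h1 := (h.freeProduct (HasForest.of_trivial (n + 1)) (by simp)).of_isomorphic
      (freeProduct_trivial_isomorphic X)
    have h2 := (h1.freeProduct (HasForest.of_trivial (n + 2)) (by simp)).of_isomorphic
      (freeProduct_trivial_isomorphic X)
    refine h2.mem_treeFamily fun s hs => ?_
    simp only [Set.mem_union, Set.mem_singleton_iff] at hs
    omega

end QuantumPermutationGroup

/-- The family of quantum automorphism groups of finite trees is the smallest family of quantum
permutation groups (up to isomorphism) which contains the trivial quantum group and is closed under
free products and under wreath products with `S_n^+`, `n ≥ 1`. -/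
theorem mainTheorem2 :
    IsLeast {I : Set QuantumPermutationGroup | QuantumPermutationGroup.IsJordanFamily I}
      QuantumPermutationGroup.treeFamily := by
  have h : QuantumPermutationGroup.treeFamily = {X | QuantumPermutationGroup.JordanClosure X} :=
    Set.ext fun _ => QuantumPermutationGroup.mem_treeFamily_iff
  rw [h]
  refine ⟨⟨fun _ _ => .isomorphic, .trivial, fun _ _ => .freeProduct, fun _ hX n _ => .wreath n hX⟩,
    fun I hI X hX => ?_⟩
  induction hX with
  | isomorphic e _ ih => exact hI.isomorphic_mem _ _ e ih
  | trivial => exact hI.trivial_mem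
  | freeProduct _ _ ih ih' => exact hI.freeProduct_mem _ _ ih ih'
  | wreath n _ ih => exact hI.wreath_mem _ ih n
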